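/- **Theorem (Completeness).** Let a countable set of predicate symbols with arities be given, let $\Gamma$ be a set of formulae such that infinitely many variables do not appear in $\Gamma$ at all (neither as an argument of an atomic subformula nor next to a quantifier; this is automatic if $\Gamma$ is finite, in particular for the elements of a finite multiset), and let $A$ be a formula. If $\Gamma\vDash A$, then $\Gamma\vdash A$. The notions are as follows. *Language.* Terms: $t ::= x_n \mid ts \mid \lambda x_n.t \mid {!t}$ ($n\in\mathbb N$), compared syntactically. Formulae: $A ::= \bot \mid t\doteq s \mid P(t_1,\dots,t_n) \mid A\to B \mid A\wedge B \mid \forall x.A \mid \mathrm K_aA \mid j{:}A$, where $x$ is a variable, $j$ a term and $a$ one of the agent names $a_0,a_1,\dots$; $\neg A$ is $A\to\bot$. A term occurs in a formula if it is one of the arguments of an atomic subformula (so $j$ in $j{:}A$ and variables inside compound terms do not count), and an occurrence of $x$ is free if it is not in the range of a $\forall x$. *Substitutions.* $t[u/v]$ is $u$ if $t$ is the variable $v$ and is $t$ otherwise. $[u/v]$ commutes with atomic formulae, $\to$, $\wedge$, $\mathrm K_a$ and $j{:}$ (leaving $j$ unchanged), and $(\forall y.A)[u/v]$ is $\forall y.A$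 if $v=y$; $\forall y.(A[u/v])$ if $v\ne y\ne u$; and $\forall z.(A[z/y][u/v])$ if $v\neq y=u$, for any $z$ that does not occur in $\forall y.A$, $u$, $v$. The simultaneous version $[t_1/x_1\dots t_n/x_n]$ is defined likewise: at $\forall y.A$ a pair with $x_i=y$ is dropped, and $y$ is renamed exactly if $y$ is one of the remaining $t_i$. The substitution of identicals $(u/v)$ has the same clauses, except that $(\mathrm K_aA)(u/v)=\mathrm K_aA$, $(j{:}A)(u/v)=j{:}A$, and the last clause for $\forall$ reads $\forall z.(A[z/y](u/v))$. Results are unique only up to the choice of the variables $z$; every choice is allowed below. *Calculus.* Sequents $\Delta\Rightarrow A$ with $\Delta$ a finite multiset, weakening and contraction on the left, and the rules (premisses / conclusion, $\Theta$ a finite multiset): $A\Rightarrow A$; $\;\Delta,A\Rightarrow B\,/\,\Delta\Rightarrow A\to B$; $\;\Delta\Rightarrow A\to B,\ \Theta\Rightarrow A\,/\,\Delta,\Theta\Rightarrow B$; $\;\Delta\Rightarrow\bot\,/\,\Delta\Rightarrow Q$ for $Q$ atomic; $\;\Delta\Rightarrow\neg\neg A\,/\,\Delta\Rightarrow A$;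 $\;\Delta\Rightarrow A,\ \Theta\Rightarrow B\,/\,\Delta,\Theta\Rightarrow A\wedge B$; $\;\Delta\Rightarrow A_1\wedge A_2\,/\,\Delta\Rightarrow A_i$; $\;\Delta\Rightarrow A[y/x]\,/\,\Delta\Rightarrow\forall x.A$ for $y$ a variable not free in $\Delta$ nor in $\forall x.A$; $\;\Delta\Rightarrow\forall x.A\,/\,\Delta\Rightarrow A[t/x]$; $\Rightarrow t\doteq t$; $\;\Delta\Rightarrow t\doteq s\,/\,\Delta\Rightarrow s\doteq t$; $\;\Delta\Rightarrow u\doteq t,\ \Theta\Rightarrow t\doteq v\,/\,\Delta,\Theta\Rightarrow u\doteq v$; $\;\Delta\Rightarrow t\doteq s,\ \Theta\Rightarrow A(t/x)\,/\,\Delta,\Theta\Rightarrow A(s/x)$; $\mathrm K_aA_1,\dots,\mathrm K_aA_n\Rightarrow A\,/\,\mathrm K_aA_1,\dots,\mathrm K_aA_n\Rightarrow\mathrm K_aA$ ($n\ge 0$); $\;\Delta\Rightarrow\mathrm K_a(A\to B),\ \Theta\Rightarrow\mathrm K_aA\,/\,\Delta,\Theta\Rightarrow\mathrm K_aB$; $\;\Delta\Rightarrow\mathrm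 K_aA\,/\,\Delta\Rightarrow A$; $\;\Delta\Rightarrow\neg\mathrm K_aA\,/\,\Delta\Rightarrow\mathrm K_a\neg\mathrm K_aA$; $\Delta\Rightarrow j{:}(A\to B),\ \Theta\Rightarrow k{:}A\,/\,\Delta,\Theta\Rightarrow jk{:}B$; $\;\Delta\Rightarrow j{:}A\,/\,\Delta\Rightarrow A$; $\;\Delta\Rightarrow j{:}A\,/\,\Delta\Rightarrow{!j}{:}(j{:}A)$; $\;\Delta\Rightarrow k{:}(t\doteq s),\ \Theta\Rightarrow j{:}A(t/x)\,/\,\Delta,\Theta\Rightarrow j{:}A(s/x)$, and the same with $k{:}(s\doteq t)$ in the first premiss. $\Gamma\vdash A$ means that $\Delta\Rightarrow A$ is derivable for some finite multiset $\Delta$ of elements of $\Gamma$. *Models.* A model consists of a non-empty set $W$ of states; a reflexive and Euclidean relation $R_a$ on $W$ for each agent name $a$; a reflexive and transitive relation $R_\gamma$ on $W$; a non-empty set $U$; for each $w\in W$ an interpretation $I_w$ that sends terms to elements of $U$ in a way that is onto $U$ and does not depend on $w$, sends $\doteq$ to an equivalence relation on $U$, and each $n$-ary $P$ to a subset of $U^n$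 such that if $(e_1,\dots,e_n)\in I_w(P)$ and $(e_i,d)\in I_w(\doteq)$, then replacing by $d$ all the $e_k$ equal to $e_i$ gives an element of $I_w(P)$; and sets $E_w(t)$ of formulae such that $E_w(t)\subseteq E_v(t)$ if $wR_\gamma v$; $A\in E_w(j)$ implies $j{:}A\in E_w(!j)$; $A\to B\in E_w(j)$ and $A\in E_w(k)$ imply $B\in E_w(jk)$; and if $A(t/x)\in E_w(j)$ and $t\doteq s\in E_w(k)$ or $s\doteq t\in E_w(k)$ for some $k$, then $A(s/x)\in E_w(j)$. *Truth.* An assignment $f$ sends each term to an element of $U$, $\doteq$ to a subset of $U^2$ and each $n$-ary $P$ to a subset of $U^n$; an $x$-variant of $f$ may differ from $f$ only on the term $x$; $f_{w\hookrightarrow v}$ agrees with $f$ on terms and with $I_v$ on $\doteq$ and predicate symbols. Truth at $w$ under $f$: atomic formulae, $\bot$, $\to$, $\wedge$ as usual by means of $f$; $\forall x.A$ is true if $A$ is true at $w$ under every $x$-variant of $f$; $\mathrm K_aA$ is true if $A$ is true at $v$ under $f_{w\hookrightarrow v}$ whenever $wR_av$; $j{:}A$ is true if $A$ is true at $v$ under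 $f_{w\hookrightarrow v}$ whenever $wR_\gamma v$ and, with $x_1,\dots,x_n$ all the free variables of $A$, there are terms $t_1,\dots,t_n$ with $f(t_i)=f(x_i)$ for all $i$ and $A[t_1/x_1\dots t_n/x_n]\in E_w(j)$. $\Gamma\vDash A$ means that for every model and every state $w$, if all elements of $\Gamma$ are true at $w$ under $I_w$, then so is $A$. -/

import Mathlib

universe u

namespace EJL

/-- Terms: variables `x_n`, application `ts`, abstraction `λ x_n. t`, and `!t`. They are compared
syntactically. -/
inductive Term : Type where
  | var (n : ℕ) : Term
  | app (t s : Term) : Term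
  | lam (n : ℕ) (t : Term) : Term
  | bang (t : Term) : Term

/-- The set containing the variable `x` if the term is `x` itself, and empty otherwise. (A variable
inside a compound term is not an occurrence of that variable in a formula.) -/
def Term.asVar : Term → Finset ℕ
  | .var n => {n}
  | _ => ∅

/-- Formulae over predicate symbols `P` of arity `ar P`; agent names are natural numbers. -/
inductive Formula {Pred : Type u} (ar : Pred → ℕ) : Type u where
  | bot : Formula ar
  | eq (t s : Term) : Formula ar
  | pred (P : Pred) (ts : Fin (ar P) → Term) : Formula ar
  | imp (A B : Formula ar) : Formula ar
  | and (A B : Formula ar) : Formula ar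
  | all (x : ℕ) (A : Formula ar) : Formula ar
  | know (a : ℕ) (A : Formula ar) : Formula ar
  | just (j : Term) (A : Formula ar) : Formula ar

namespace Formula

/-- `¬A` is `A → ⊥`. -/
def neg {Pred : Type u} {ar : Pred → ℕ} (A : Formula ar) : Formula ar := .imp A .bot

/-- The variables that occur (free or bound) as terms in a formula, that is, as one of the arguments
of an atomic subformula. The `j` displayed in `j : A` is not an occurrence, nor is the `x` of a
quantifier `∀ x`. -/
def occurring {Pred : Type u} {ar : Pred → ℕ} : Formula ar → Finset ℕ
  | bot => ∅
  | eq t s => t.asVar ∪ s.asVar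
  | pred _ ts => Finset.univ.biUnion fun i => (ts i).asVar
  | imp A B => A.occurring ∪ B.occurring
  | and A B => A.occurring ∪ B.occurring
  | all _ A => A.occurring
  | know _ A => A.occurring
  | just _ A => A.occurring

/-- The free variables of a formula. -/
def freeVars {Pred : Type u} {ar : Pred → ℕ} : Formula ar → Finset ℕ
  | bot => ∅
  | eq t s => t.asVar ∪ s.asVar
  | pred _ ts => Finset.univ.biUnion fun i => (ts i).asVar
  | imp A B => A.freeVars ∪ B.freeVars
  | and A B => A.freeVars ∪ B.freeVars
  | all x A => A.freeVars.erase x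
  | know _ A => A.freeVars
  | just _ A => A.freeVars

/-- The variables `x` for which a quantifier `∀ x` appears in the formula. -/
def quantified {Pred : Type u} {ar : Pred → ℕ} : Formula ar → Finset ℕ
  | bot => ∅
  | eq _ _ => ∅
  | pred _ _ => ∅
  | imp A B => A.quantified ∪ B.quantified
  | and A B => A.quantified ∪ B.quantified
  | all x A => insert x A.quantified
  | know _ A => A.quantified
  | just _ A => A.quantified

end Formula

/-- `t[t₁/x₁ … tₙ/xₙ]` for the list `l` of the pairs `(xᵢ, tᵢ)`: the term `tᵢ` if `t` is the variable
`xᵢ`, and `t` itself otherwise. -/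
def Term.replace (l : List (ℕ × Term)) : Term → Term
  | .var n => (l.lookup n).getD (.var n)
  | t => t

/-- `Subst l A B`: the formula `B` is a result of the simultaneous quantifier instantiating
substitution `A[t₁/x₁ … tₙ/xₙ]`, where `l` is the list of the pairs `(xᵢ, tᵢ)`. It is a relation
because the variable `z` chosen to rename a bound variable is any one that does not occur.
For `l = [(v, u)]` the clauses for `∀ y. A` are those of `[u/v]`: nothing happens if `v = y`
(the remaining list is then empty), the substitution goes inside if `v ≠ y ≠ u`, and
`(∀ y. A)[u/v] = ∀ z. (A[z/y][u/v])` if `v ≠ y = u`. -/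
inductive Subst {Pred : Type u} {ar : Pred → ℕ} :
    List (ℕ × Term) → Formula ar → Formula ar → Prop where
  | bot (l : List (ℕ × Term)) : Subst l .bot .bot
  | eq (l : List (ℕ × Term)) (t s : Term) : Subst l (.eq t s) (.eq (t.replace l) (s.replace l))
  | pred (l : List (ℕ × Term)) (P : Pred) (ts : Fin (ar P) → Term) :
      Subst l (.pred P ts) (.pred P fun i => (ts i).replace l)
  | imp {l : List (ℕ × Term)} {A A' B B' : Formula ar} :
      Subst l A A' → Subst l B B' → Subst l (.imp A B) (.imp A' B')
  | and {l : List (ℕ × Term)} {A A' B B' : Formula ar} :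
      Subst l A A' → Subst l B B' → Subst l (.and A B) (.and A' B')
  | all_keep {l l' : List (ℕ × Term)} {y : ℕ} {A A' : Formula ar} :
      l' = l.filter (fun p => p.1 ≠ y) → (∀ p ∈ l', p.2 ≠ .var y) →
      Subst l' A A' → Subst l (.all y A) (.all y A')
  | all_rename {l l' : List (ℕ × Term)} {y z : ℕ} {A A' A'' : Formula ar} :
      l' = l.filter (fun p => p.1 ≠ y) → (∃ p ∈ l', p.2 = .var y) →
      z ∉ (Formula.all y A).occurring → (∀ p ∈ l', p.1 ≠ z ∧ p.2 ≠ .var z) →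
      Subst [(y, .var z)] A A' → Subst l' A' A'' → Subst l (.all y A) (.all z A'')
  | know {l : List (ℕ × Term)} {a : ℕ} {A A' : Formula ar} :
      Subst l A A' → Subst l (.know a A) (.know a A')
  | just {l : List (ℕ × Term)} {j : Term} {A A' : Formula ar} :
      Subst l A A' → Subst l (.just j A) (.just j A')

/-- `IdSubst u v A B`: the formula `B` is a result of the substitution of identicals `A(u/v)`, which
does not go inside `K_a` and `j :`. The renaming of a bound variable is the ordinary one, and hence
also acts on its occurrences inside `K_a` and `j :`. -/
inductive IdSubst {Pred : Type u} {ar : Pred → ℕ} (u : Term) (v : ℕ) :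
    Formula ar → Formula ar → Prop where
  | bot : IdSubst u v .bot .bot
  | eq (t s : Term) : IdSubst u v (.eq t s) (.eq (t.replace [(v, u)]) (s.replace [(v, u)]))
  | pred (P : Pred) (ts : Fin (ar P) → Term) :
      IdSubst u v (.pred P ts) (.pred P fun i => (ts i).replace [(v, u)])
  | imp {A A' B B' : Formula ar} :
      IdSubst u v A A' → IdSubst u v B B' → IdSubst u v (.imp A B) (.imp A' B')
  | and {A A' B B' : Formula ar} :
      IdSubst u v A A' → IdSubst u v B B' → IdSubst u v (.and A B) (.and A' B')
  | all_same (A : Formula ar) : IdSubst u v (.all v A) (.all v A)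
  | all_keep {y : ℕ} {A A' : Formula ar} :
      v ≠ y → u ≠ .var y → IdSubst u v A A' → IdSubst u v (.all y A) (.all y A')
  | all_rename {y z : ℕ} {A A' A'' : Formula ar} :
      v ≠ y → u = .var y → z ∉ (Formula.all y A).occurring → u ≠ .var z → v ≠ z →
      Subst [(y, .var z)] A A' → IdSubst u v A' A'' → IdSubst u v (.all y A) (.all z A'')
  | know (a : ℕ) (A : Formula ar) : IdSubst u v (.know a A) (.know a A)
  | just (j : Term) (A : Formula ar) : IdSubst u v (.just j A) (.just j A)

/-- `Deriv Γ A`: the sequent `Γ ⇒ A` is derivable in the natural deduction calculus. -/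
inductive Deriv {Pred : Type u} {ar : Pred → ℕ} : Multiset (Formula ar) → Formula ar → Prop where
  -- structural rules
  | weaken {Γ : Multiset (Formula ar)} {A B : Formula ar} : Deriv Γ B → Deriv (A ::ₘ Γ) B
  | contract {Γ : Multiset (Formula ar)} {A B : Formula ar} :
      Deriv (A ::ₘ A ::ₘ Γ) B → Deriv (A ::ₘ Γ) B
  -- connectives and quantifiers
  | ax (A : Formula ar) : Deriv {A} A
  | imp_intro {Γ : Multiset (Formula ar)} {A B : Formula ar} :
      Deriv (A ::ₘ Γ) B → Deriv Γ (.imp A B)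
  | imp_elim {Γ Δ : Multiset (Formula ar)} {A B : Formula ar} :
      Deriv Γ (.imp A B) → Deriv Δ A → Deriv (Γ + Δ) B
  | bot_elim_eq {Γ : Multiset (Formula ar)} (t s : Term) : Deriv Γ .bot → Deriv Γ (.eq t s)
  | bot_elim_pred {Γ : Multiset (Formula ar)} (P : Pred) (ts : Fin (ar P) → Term) :
      Deriv Γ .bot → Deriv Γ (.pred P ts)
  | neg_neg_elim {Γ : Multiset (Formula ar)} {A : Formula ar} : Deriv Γ A.neg.neg → Deriv Γ A
  | and_intro {Γ Δ : Multiset (Formula ar)} {A B : Formula ar} :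
      Deriv Γ A → Deriv Δ B → Deriv (Γ + Δ) (.and A B)
  | and_left {Γ : Multiset (Formula ar)} {A B : Formula ar} : Deriv Γ (.and A B) → Deriv Γ A
  | and_right {Γ : Multiset (Formula ar)} {A B : Formula ar} : Deriv Γ (.and A B) → Deriv Γ B
  | all_intro {Γ : Multiset (Formula ar)} {x y : ℕ} {A B : Formula ar} :
      Subst [(x, .var y)] A B → (∀ G ∈ Γ, y ∉ G.freeVars) → y ∉ (Formula.all x A).freeVars →
      Deriv Γ B → Deriv Γ (.all x A)
  | all_elim {Γ : Multiset (Formula ar)} {x : ℕ} {t : Term} {A B : Formula ar} :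
      Subst [(x, t)] A B → Deriv Γ (.all x A) → Deriv Γ B
  -- identity
  | eq_refl (t : Term) : Deriv 0 (.eq t t)
  | eq_symm {Γ : Multiset (Formula ar)} {t s : Term} : Deriv Γ (.eq t s) → Deriv Γ (.eq s t)
  | eq_trans {Γ Δ : Multiset (Formula ar)} {r t s : Term} :
      Deriv Γ (.eq r t) → Deriv Δ (.eq t s) → Deriv (Γ + Δ) (.eq r s)
  | eq_subst {Γ Δ : Multiset (Formula ar)} {t s : Term} {x : ℕ} {A B C : Formula ar} :
      IdSubst t x A B → IdSubst s x A C →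
      Deriv Γ (.eq t s) → Deriv Δ B → Deriv (Γ + Δ) C
  -- knowledge
  | know_intro {Γ : Multiset (Formula ar)} {a : ℕ} {A : Formula ar} :
      Deriv (Γ.map (Formula.know a)) A → Deriv (Γ.map (Formula.know a)) (.know a A)
  | know_imp {Γ Δ : Multiset (Formula ar)} {a : ℕ} {A B : Formula ar} :
      Deriv Γ (.know a (.imp A B)) → Deriv Δ (.know a A) → Deriv (Γ + Δ) (.know a B)
  | know_elim {Γ : Multiset (Formula ar)} {a : ℕ} {A : Formula ar} :
      Deriv Γ (.know a A) → Deriv Γ A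
  | know_neg {Γ : Multiset (Formula ar)} {a : ℕ} {A : Formula ar} :
      Deriv Γ (Formula.know a A).neg → Deriv Γ (.know a (Formula.know a A).neg)
  -- justifications
  | just_app {Γ Δ : Multiset (Formula ar)} {j k : Term} {A B : Formula ar} :
      Deriv Γ (.just j (.imp A B)) → Deriv Δ (.just k A) → Deriv (Γ + Δ) (.just (.app j k) B)
  | just_elim {Γ : Multiset (Formula ar)} {j : Term} {A : Formula ar} :
      Deriv Γ (.just j A) → Deriv Γ A
  | just_bang {Γ : Multiset (Formula ar)} {j : Term} {A : Formula ar} :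
      Deriv Γ (.just j A) → Deriv Γ (.just (.bang j) (.just j A))
  | just_subst {Γ Δ : Multiset (Formula ar)} {j k t s : Term} {x : ℕ} {A B C : Formula ar} :
      IdSubst t x A B → IdSubst s x A C →
      Deriv Γ (.just k (.eq t s)) → Deriv Δ (.just j B) → Deriv (Γ + Δ) (.just j C)
  | just_subst_symm {Γ Δ : Multiset (Formula ar)} {j k t s : Term} {x : ℕ} {A B C : Formula ar} :
      IdSubst t x A B → IdSubst s x A C →
      Deriv Γ (.just k (.eq s t)) → Deriv Δ (.just j B) → Deriv (Γ + Δ) (.just j C)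

/-- `Σ ⊢ A`: some sequent `Γ ⇒ A` with `Γ` a finite multiset of elements of `Σ` is derivable. -/
def Derivable {Pred : Type u} {ar : Pred → ℕ} (S : Set (Formula ar)) (A : Formula ar) : Prop :=
  ∃ Γ : Multiset (Formula ar), (∀ G ∈ Γ, G ∈ S) ∧ Deriv Γ A

/-- An assignment into `U` interprets every term, identity, and every predicate symbol. -/
structure Assignment {Pred : Type u} (ar : Pred → ℕ) (U : Type u) : Type u where
  term : Term → U
  eq : U → U → Prop
  pred : (P : Pred) → (Fin (ar P) → U) → Prop

/-- `g` is an `x`-variant of `f`: it differs from `f` at most on the term `x`. -/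
def Assignment.IsVariant {Pred : Type u} {ar : Pred → ℕ} {U : Type u} (x : ℕ)
    (f g : Assignment ar U) : Prop :=
  (∀ t : Term, t ≠ .var x → g.term t = f.term t) ∧ g.eq = f.eq ∧ g.pred = f.pred

/-- Models `(W, R, U, I, E)`; `R` interprets the agent names and `Rγ` the symbol `γ`. -/
structure Model {Pred : Type u} (ar : Pred → ℕ) : Type (u + 1) where
  W : Type u
  nonempty_W : Nonempty W
  R : ℕ → W → W → Prop
  R_refl : ∀ a w, R a w w
  R_eucl : ∀ a w s v, R a w s → R a w v → R a s v
  Rγ : W → W → Prop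
  Rγ_refl : ∀ w, Rγ w w
  Rγ_trans : ∀ w v s, Rγ w v → Rγ v s → Rγ w s
  U : Type u
  nonempty_U : Nonempty U
  I : W → Assignment ar U
  I_rigid : ∀ w v t, (I w).term t = (I v).term t
  I_surj : ∀ w e, ∃ t, (I w).term t = e
  eq_refl : ∀ w e, (I w).eq e e
  eq_symm : ∀ w d e, (I w).eq d e → (I w).eq e d
  eq_trans : ∀ w c d e, (I w).eq c d → (I w).eq d e → (I w).eq c e
  /-- closure under the uniform replacement of `e i` by `d` -/
  pred_congr : ∀ w (P : Pred) (e e' : Fin (ar P) → U) (i : Fin (ar P)) (d : U),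
    (I w).pred P e → (I w).eq (e i) d →
    (∀ k, (e k ≠ e i → e' k = e k) ∧ (e k = e i → e' k = d)) → (I w).pred P e'
  E : W → Term → Set (Formula ar)
  E_mono : ∀ w v t, Rγ w v → E w t ⊆ E v t
  E_bang : ∀ w j A, A ∈ E w j → Formula.just j A ∈ E w (.bang j)
  E_app : ∀ w j k A B, Formula.imp A B ∈ E w j → A ∈ E w k → B ∈ E w (.app j k)
  E_subst : ∀ w j t s x (A B C : Formula ar), IdSubst t x A B → IdSubst s x A C → B ∈ E w j →
    (∃ k, Formula.eq t s ∈ E w k ∨ Formula.eq s t ∈ E w k) → C ∈ E w j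

/-- The combination `f_{w ↪ v}`: terms are interpreted as by `f`, and identity and the predicate
symbols as by `I_v`. -/
def Model.shift {Pred : Type u} {ar : Pred → ℕ} (M : Model ar) (f : Assignment ar M.U) (v : M.W) :
    Assignment ar M.U :=
  { term := f.term, eq := (M.I v).eq, pred := (M.I v).pred }

/-- Truth of a formula at the state `w` under the assignment `f`. In the clause for `j : A`, the list
`l` consists of the pairs `(xᵢ, tᵢ)`, where `x₁, …, xₙ` are all the free variables of `A`. -/
def Model.Forces {Pred : Type u} {ar : Pred → ℕ} (M : Model ar) :
    M.W → Assignment ar M.U → Formula ar → Prop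
  | _, _, .bot => False
  | _, f, .eq t s => f.eq (f.term t) (f.term s)
  | _, f, .pred P ts => f.pred P fun i => f.term (ts i)
  | w, f, .imp A B => M.Forces w f A → M.Forces w f B
  | w, f, .and A B => M.Forces w f A ∧ M.Forces w f B
  | w, f, .all x A => ∀ g : Assignment ar M.U, f.IsVariant x g → M.Forces w g A
  | w, f, .know a A => ∀ v, M.R a w v → M.Forces v (M.shift f v) A
  | w, f, .just j A =>
      (∀ v, M.Rγ w v → M.Forces v (M.shift f v) A) ∧
      ∃ l : List (ℕ × Term),
        (l.map Prod.fst).Nodup ∧ (∀ x, x ∈ l.map Prod.fst ↔ x ∈ A.freeVars) ∧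
        (∀ p ∈ l, f.term p.2 = f.term (.var p.1)) ∧
        ∃ B, Subst l A B ∧ B ∈ M.E w j

/-- `Γ ⊨ A`: at every state `w` of every model at which, under the assignment `I_w`, all elements of
`Γ` are true, `A` is true too. -/
def Entails {Pred : Type u} {ar : Pred → ℕ} (S : Set (Formula ar)) (A : Formula ar) : Prop :=
  ∀ (M : Model ar) (w : M.W), (∀ G ∈ S, M.Forces w (M.I w) G) → M.Forces w (M.I w) A

end EJL

/-! The proof builds a canonical model of Henkin type. If `A` is not derivable from `Γ`, then `Γ`
together with `¬A` extends to a maximally consistent set in which every universal formula outside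
the set has an instance at a variable that is also outside it (`Saturated`, `exists_saturated`). The
states are all such sets, the domain is the set of terms, and truth at a state is membership in it
(`canonicalModel_forces_iff`). Three difficulties shape the argument.

Bound variables. Substitution is determined only up to renaming, and no rule renames under `K_a` or
`j :`. But every choice of the new variable is allowed, so in an instance of `∀ x. (C → C)` the two
copies of `C` may be resolved differently. As substitution enters the modal operators, renaming is
provable everywhere (`Variant.deriv`). Hence formulae with the same de Bruijn translation
`Formula.cls` are interderivable (`Formula.deriv_imp_of_cls_eq`), and substitutions can be computed
on these translations.

Successors for `K_a`. The set of all `B` with `K_a B` in a saturated set mentions every variable, so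
no fresh witnesses are left. The Barcan formula, which holds because `K_a` is an S5 operator
(`Derivable.barcan`), transfers the witnesses of the given state to the successor
(`Saturated.exists_know`).

Justifications. The sets `E_w(j)` contain formulae and do not depend on the assignment, whereas
quantifiers change the values of variables. An infinite set `D` of variables foreign to `Γ` and `A`
is therefore reserved; `δ` maps `D` onto all variables and fixes the others. Variables of `D` name
all variables of the domain (other terms name themselves), and they keep their values while `A` is
evaluated, since no quantifier of `A` binds them. A formula is admitted as evidence only if its
reading depends on the values on `D` alone. This gives the clause for `j :`
(`Saturated.forces_just_iff`), and the closure conditions on `E` follow from the rules for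
justifications. -/

namespace EJL

variable {Pred : Type u} {ar : Pred → ℕ}

/-! ### Nameless formulae -/

/-- Arguments of atomic nameless formulae: ordinary terms and de Bruijn indices. -/
inductive LTerm : Type where
  | free (t : Term) : LTerm
  | bound (n : ℕ) : LTerm

/-- Formulae in which bound variables are de Bruijn indices. -/
inductive LFormula {Pred : Type u} (ar : Pred → ℕ) : Type u where
  | bot : LFormula ar
  | eq (t s : LTerm) : LFormula ar
  | pred (P : Pred) (ts : Fin (ar P) → LTerm) : LFormula ar
  | imp (A B : LFormula ar) : LFormula ar
  | and (A B : LFormula ar) : LFormula ar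
  | all (A : LFormula ar) : LFormula ar
  | know (a : ℕ) (A : LFormula ar) : LFormula ar
  | just (j : Term) (A : LFormula ar) : LFormula ar

/-- The effect on an argument of passing under a quantifier. -/
def LTerm.shift : LTerm → LTerm
  | free t => free t
  | bound n => bound (n + 1)

/-- The value of a term when the variables are read by `ρ`. -/
def Term.eval (ρ : ℕ → LTerm) : Term → LTerm
  | var n => ρ n
  | app t s => .free (app t s)
  | lam n t => .free (lam n t)
  | bang t => .free (bang t)

/-- The reading of variables inside the range of a quantifier `∀ x`. -/
def bindEnv (x : ℕ) (ρ : ℕ → LTerm) (n : ℕ) : LTerm :=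
  if n = x then .bound 0 else (ρ n).shift

namespace Formula

/-- The nameless translation: variables are read by `ρ₁` outside the modal operators `K_a` and `j :`,
and by `ρ₂` inside them. -/
def tr (ρ₁ ρ₂ : ℕ → LTerm) : Formula ar → LFormula ar
  | bot => .bot
  | eq t s => .eq (t.eval ρ₁) (s.eval ρ₁)
  | pred P ts => .pred P fun i => (ts i).eval ρ₁
  | imp A B => .imp (A.tr ρ₁ ρ₂) (B.tr ρ₁ ρ₂)
  | and A B => .and (A.tr ρ₁ ρ₂) (B.tr ρ₁ ρ₂)
  | all x A => .all (A.tr (bindEnv x ρ₁) (bindEnv x ρ₂))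
  | know a A => .know a (A.tr ρ₂ ρ₂)
  | just j A => .just j (A.tr ρ₂ ρ₂)

/-- The class of a formula up to renaming of bound variables. -/
def cls (A : Formula ar) : LFormula ar :=
  A.tr (fun n => .free (.var n)) (fun n => .free (.var n))

theorem freeVars_subset_occurring (A : Formula ar) : A.freeVars ⊆ A.occurring := by
  induction A with
  | imp A B ihA ihB => exact Finset.union_subset_union ihA ihB
  | and A B ihA ihB => exact Finset.union_subset_union ihA ihB
  | all x A ih => exact (Finset.erase_subset _ _).trans ih
  | know a A ih => exact ih
  | just j A ih => exact ih
  | _ => exact subset_rfl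

end Formula

theorem Term.eval_congr {ρ ρ' : ℕ → LTerm} {t : Term} (h : ∀ x ∈ t.asVar, ρ x = ρ' x) :
    t.eval ρ = t.eval ρ' := by
  cases t <;> simp_all [Term.eval, Term.asVar]

namespace Formula

theorem tr_congr {A : Formula ar} {ρ₁ ρ₂ ρ₁' ρ₂' : ℕ → LTerm}
    (h₁ : ∀ x ∈ A.freeVars, ρ₁ x = ρ₁' x) (h₂ : ∀ x ∈ A.freeVars, ρ₂ x = ρ₂' x) :
    A.tr ρ₁ ρ₂ = A.tr ρ₁' ρ₂' := by
  induction A generalizing ρ₁ ρ₂ ρ₁' ρ₂' with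
  | bot => rfl
  | eq t s =>
    simp only [freeVars, Finset.mem_union] at h₁
    simp only [tr, Term.eval_congr fun x hx => h₁ x (.inl hx),
      Term.eval_congr fun x hx => h₁ x (.inr hx)]
  | pred P ts =>
    simp only [freeVars, Finset.mem_biUnion, Finset.mem_univ, true_and] at h₁
    simp only [tr, fun i => Term.eval_congr (t := ts i) fun x hx => h₁ x ⟨i, hx⟩]
  | imp A B ihA ihB =>
    simp only [freeVars, Finset.mem_union] at h₁ h₂
    simp only [tr, ihA (fun x hx => h₁ x (.inl hx)) (fun x hx => h₂ x (.inl hx)),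
      ihB (fun x hx => h₁ x (.inr hx)) (fun x hx => h₂ x (.inr hx))]
  | and A B ihA ihB =>
    simp only [freeVars, Finset.mem_union] at h₁ h₂
    simp only [tr, ihA (fun x hx => h₁ x (.inl hx)) (fun x hx => h₂ x (.inl hx)),
      ihB (fun x hx => h₁ x (.inr hx)) (fun x hx => h₂ x (.inr hx))]
  | all y A ih =>
    simp only [freeVars, Finset.mem_erase] at h₁ h₂
    refine congrArg LFormula.all (ih (fun x hx => ?_) (fun x hx => ?_))
    · by_cases h : x = y
      · simp [bindEnv, h]
      · simp [bindEnv, h, h₁ x ⟨h, hx⟩]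
    · by_cases h : x = y
      · simp [bindEnv, h]
      · simp [bindEnv, h, h₂ x ⟨h, hx⟩]
  | know a A ih => exact congrArg _ (ih h₂ h₂)
  | just j A ih => exact congrArg _ (ih h₂ h₂)

end Formula

/-! ### Substitutions and the nameless translation -/

/-- Reading the variables by `ρ` after a substitution. -/
def substEnv (l : List (ℕ × Term)) (ρ : ℕ → LTerm) (n : ℕ) : LTerm :=
  ((Term.var n).replace l).eval ρ

theorem Term.eval_replace (l : List (ℕ × Term)) (ρ : ℕ → LTerm) (t : Term) :
    (t.replace l).eval ρ = t.eval (substEnv l ρ) := by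
  cases t <;> rfl

theorem lookup_filter_ne (l : List (ℕ × Term)) {n y : ℕ} (h : n ≠ y) :
    (l.filter fun p => p.1 ≠ y).lookup n = l.lookup n := by
  induction l with
  | nil => rfl
  | cons p l ih =>
    obtain ⟨m, t⟩ := p
    by_cases hm : m = y
    · subst hm
      simpa [List.lookup_cons, beq_eq_false_iff_ne.2 h] using ih
    · simp_all [List.lookup_cons]

theorem mem_of_lookup {l : List (ℕ × Term)} {n : ℕ} {t : Term} (h : l.lookup n = some t) :
    (n, t) ∈ l := by
  induction l with
  | nil => simp at h
  | cons p l ih =>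
    obtain ⟨m, s⟩ := p
    by_cases hm : n = m
    · simp_all
    · have : (n == m) = false := by simp [hm]
      simp_all [List.lookup_cons]

theorem lookup_eq_none {l : List (ℕ × Term)} {n : ℕ} (h : ∀ p ∈ l, p.1 ≠ n) :
    l.lookup n = none := by
  by_contra hn
  obtain ⟨t, ht⟩ := Option.ne_none_iff_exists'.1 hn
  exact h _ (mem_of_lookup ht) rfl

theorem substEnv_of_fresh {l : List (ℕ × Term)} {n : ℕ} (h : ∀ p ∈ l, p.1 ≠ n)
    (ρ : ℕ → LTerm) : substEnv l ρ n = ρ n := by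
  simp [substEnv, Term.replace, lookup_eq_none h, Term.eval]

theorem Term.eval_bindEnv {t : Term} {z : ℕ} (h : t ≠ .var z) (ρ : ℕ → LTerm) :
    t.eval (bindEnv z ρ) = (t.eval ρ).shift := by
  cases t with
  | var n =>
    have : n ≠ z := fun e => h (e ▸ rfl)
    simp [Term.eval, bindEnv, this]
  | _ => rfl

theorem substEnv_filter_bindEnv {l : List (ℕ × Term)} {y z n : ℕ} (hn : n ≠ y)
    (hz : ∀ p ∈ l.filter (fun p => p.1 ≠ y), p.2 ≠ .var z) (hnz : n ≠ z) (ρ : ℕ → LTerm) :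
    substEnv (l.filter fun p => p.1 ≠ y) (bindEnv z ρ) n = (substEnv l ρ n).shift := by
  simp only [substEnv, Term.replace]
  cases h : l.lookup n with
  | none =>
    rw [lookup_filter_ne l hn, h]
    exact Term.eval_bindEnv (fun e => hnz (Term.var.inj e)) ρ
  | some t =>
    rw [← lookup_filter_ne l hn] at h
    have := hz _ (mem_of_lookup h)
    rw [h]
    exact Term.eval_bindEnv this ρ

/-- The right-hand side does not mention the renaming variables, so all results of one substitution
have the same class. -/
theorem Subst.tr_eq {l : List (ℕ × Term)} {A B : Formula ar} (h : Subst l A B)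
    (ρ₁ ρ₂ : ℕ → LTerm) : B.tr ρ₁ ρ₂ = A.tr (substEnv l ρ₁) (substEnv l ρ₂) := by
  induction h generalizing ρ₁ ρ₂ with
  | bot => rfl
  | eq l t s => simp only [Formula.tr, Term.eval_replace]
  | pred l P ts => simp only [Formula.tr, Term.eval_replace]
  | imp _ _ ihA ihB => simp only [Formula.tr, ihA, ihB]
  | and _ _ ihA ihB => simp only [Formula.tr, ihA, ihB]
  | @all_keep l l' y A A' hl hy _ ih =>
    subst hl
    have key (ρ : ℕ → LTerm) : substEnv (l.filter fun p => p.1 ≠ y) (bindEnv y ρ) =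
        bindEnv y (substEnv l ρ) := by
      funext n
      by_cases hn : n = y
      · subst hn
        rw [substEnv_of_fresh (fun p hp => by simpa using (List.mem_filter.1 hp).2)]
        simp [bindEnv]
      · rw [substEnv_filter_bindEnv hn hy hn]
        simp [bindEnv, hn]
    simp only [Formula.tr, ih, key]
  | @all_rename l l' y z A A' A'' hl _ hz hlz _ _ ih₁ ih₂ =>
    subst hl
    -- The two environments differ at `z`; agreement on the free variables of `A` is enough for
    -- `Formula.tr_congr`.
    have key (ρ : ℕ → LTerm) (n : ℕ) (hn : n ∈ A.freeVars) :
        substEnv [(y, .var z)] (substEnv (l.filter fun p => p.1 ≠ y) (bindEnv z ρ)) n =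
        bindEnv y (substEnv l ρ) n := by
      have hnz : n ≠ z := fun e => hz (e ▸ A.freeVars_subset_occurring hn)
      by_cases hny : n = y
      · subst hny
        have : substEnv [(n, .var z)] (substEnv (l.filter fun p => p.1 ≠ n) (bindEnv z ρ)) n =
            substEnv (l.filter fun p => p.1 ≠ n) (bindEnv z ρ) z := by
          simp [substEnv, Term.replace, Term.eval]
        rw [this, substEnv_of_fresh fun p hp => (hlz p hp).1]
        simp [bindEnv]
      · rw [substEnv_of_fresh (by simpa using fun e => hny e.symm),
          substEnv_filter_bindEnv hny (fun p hp => (hlz p hp).2) hnz]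
        simp [bindEnv, hny]
    simp only [Formula.tr, ih₁, ih₂]
    exact congrArg _ (Formula.tr_congr (key ρ₁) (key ρ₂))
  | know _ ih => simp only [Formula.tr, ih]
  | just _ ih => simp only [Formula.tr, ih]

theorem substEnv_singleton (v : ℕ) (u : Term) (ρ : ℕ → LTerm) :
    substEnv [(v, u)] ρ = Function.update ρ v (u.eval ρ) := by
  funext n
  by_cases h : n = v
  · subst h; simp [substEnv, Term.replace]
  · rw [substEnv_of_fresh (by simpa using fun e => h e.symm)]
    simp [h]

theorem bindEnv_update_self (y : ℕ) (ρ : ℕ → LTerm) (r : LTerm) :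
    bindEnv y (Function.update ρ y r) = bindEnv y ρ := by
  funext n
  by_cases h : n = y <;> simp [bindEnv, h]

theorem bindEnv_update {x y : ℕ} (h : x ≠ y) (ρ : ℕ → LTerm) (r : LTerm) :
    bindEnv y (Function.update ρ x r) = Function.update (bindEnv y ρ) x r.shift := by
  funext n
  by_cases hx : n = x
  · subst hx; simp [bindEnv, h]
  · by_cases hy : n = y
    · subst hy; simp [bindEnv, hx]
    · simp [bindEnv, hx, hy]

/-- This is why `Formula.tr` carries two environments: identicals are replaced only outside the
modal operators, so `ρ₂` stays as it is. The renaming of bound variables does enter them, but leaves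
no trace in the translation. -/
theorem IdSubst.tr_eq {u : Term} {v : ℕ} {A B : Formula ar} (h : IdSubst u v A B)
    (ρ₁ ρ₂ : ℕ → LTerm) : B.tr ρ₁ ρ₂ = A.tr (Function.update ρ₁ v (u.eval ρ₁)) ρ₂ := by
  induction h generalizing ρ₁ ρ₂ with
  | bot => rfl
  | eq t s => simp only [Formula.tr, Term.eval_replace, substEnv_singleton]
  | pred P ts => simp only [Formula.tr, Term.eval_replace, substEnv_singleton]
  | imp _ _ ihA ihB => simp only [Formula.tr, ihA, ihB]
  | and _ _ ihA ihB => simp only [Formula.tr, ihA, ihB]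
  | all_same A => simp only [Formula.tr, bindEnv_update_self]
  | all_keep hv hu _ ih => simp only [Formula.tr, ih, bindEnv_update hv, Term.eval_bindEnv hu]
  | @all_rename y z A A' A'' hv hu hz huz hvz hA _ ih =>
    simp only [Formula.tr, ih, hA.tr_eq, substEnv_singleton, bindEnv_update hv]
    refine congrArg _ (Formula.tr_congr (fun n hn => ?_) (fun n hn => ?_))
    all_goals
      have hnz : n ≠ z := fun e => hz (e ▸ A.freeVars_subset_occurring hn)
      by_cases hny : n = y
      · subst hny
        simp [bindEnv, hvz.symm, hv.symm, Term.eval]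
      · by_cases hnv : n = v
        · subst hnv; simp [bindEnv, hny, hnz, Term.eval_bindEnv huz]
        · simp [bindEnv, hnz, hny, hnv]
  | know a A => rfl
  | just j A => rfl

/-! ### Maps of nameless formulae -/

/-- The extension of a map of arguments to the range of a quantifier. -/
def LTerm.lift (g : LTerm → LTerm) : LTerm → LTerm
  | bound 0 => bound 0
  | bound (n + 1) => (g (bound n)).shift
  | free t => (g (free t)).shift

/-- Replacement of the arguments of atomic formulae by `g₁` outside the modal operators and by `g₂`
inside them. -/
def LFormula.map (g₁ g₂ : LTerm → LTerm) : LFormula ar → LFormula ar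
  | bot => bot
  | eq t s => eq (g₁ t) (g₁ s)
  | pred P ts => pred P fun i => g₁ (ts i)
  | imp A B => imp (A.map g₁ g₂) (B.map g₁ g₂)
  | and A B => and (A.map g₁ g₂) (B.map g₁ g₂)
  | all A => all (A.map (LTerm.lift g₁) (LTerm.lift g₂))
  | know a A => know a (A.map g₂ g₂)
  | just j A => just j (A.map g₂ g₂)

/-- `g` fixes the terms that are not variables. -/
def FixesCompound (g : LTerm → LTerm) : Prop := ∀ t : Term, t.asVar = ∅ → g (.free t) = .free t

theorem FixesCompound.lift {g : LTerm → LTerm} (h : FixesCompound g) :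
    FixesCompound (LTerm.lift g) := fun t ht => by
  simp [LTerm.lift, h t ht, LTerm.shift]

theorem FixesCompound.eval {g : LTerm → LTerm} (h : FixesCompound g) (ρ : ℕ → LTerm) (t : Term) :
    g (t.eval ρ) = t.eval (g ∘ ρ) := by
  cases t with
  | var n => rfl
  | _ => exact h _ rfl

theorem lift_comp_bindEnv (g : LTerm → LTerm) (x : ℕ) (ρ : ℕ → LTerm) :
    LTerm.lift g ∘ bindEnv x ρ = bindEnv x (g ∘ ρ) := by
  funext n
  by_cases h : n = x
  · simp [bindEnv, h, LTerm.lift]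
  · cases hr : ρ n <;> simp [bindEnv, h, hr, LTerm.shift, LTerm.lift]

theorem Formula.map_tr {g₁ g₂ : LTerm → LTerm} (h₁ : FixesCompound g₁) (h₂ : FixesCompound g₂)
    (A : Formula ar) (ρ₁ ρ₂ : ℕ → LTerm) :
    (A.tr ρ₁ ρ₂).map g₁ g₂ = A.tr (g₁ ∘ ρ₁) (g₂ ∘ ρ₂) := by
  induction A generalizing ρ₁ ρ₂ g₁ g₂ with
  | bot => rfl
  | eq t s => simp only [tr, LFormula.map, h₁.eval]
  | pred P ts => simp only [tr, LFormula.map, h₁.eval]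
  | imp A B ihA ihB => simp only [tr, LFormula.map, ihA h₁ h₂, ihB h₁ h₂]
  | and A B ihA ihB => simp only [tr, LFormula.map, ihA h₁ h₂, ihB h₁ h₂]
  | all x A ih => simp only [tr, LFormula.map, ih h₁.lift h₂.lift, lift_comp_bindEnv]
  | know a A ih => simp only [tr, LFormula.map, ih h₂ h₂]
  | just j A ih => simp only [tr, LFormula.map, ih h₂ h₂]

/-- Instantiation of the outermost de Bruijn index. -/
def LTerm.inst (r : LTerm) : LTerm → LTerm
  | bound 0 => r
  | bound (n + 1) => bound n
  | free t => free t

theorem inst_comp_bindEnv (r : LTerm) (x : ℕ) (ρ : ℕ → LTerm) :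
    LTerm.inst r ∘ bindEnv x ρ = Function.update ρ x r := by
  funext n
  by_cases h : n = x
  · subst h; simp [bindEnv, LTerm.inst]
  · cases hr : ρ n <;> simp [bindEnv, h, hr, LTerm.shift, LTerm.inst]

/-- Universal formulae of the same class have instances of the same class: `LTerm.inst` fills the
outermost index on both sides. -/
theorem Formula.tr_update_of_bindEnv {A B : Formula ar} {x z : ℕ} {ρ ρ' : ℕ → LTerm}
    (h : A.tr (bindEnv x ρ) (bindEnv x ρ) = B.tr (bindEnv z ρ') (bindEnv z ρ')) (r : LTerm) :
    A.tr (Function.update ρ x r) (Function.update ρ x r) =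
      B.tr (Function.update ρ' z r) (Function.update ρ' z r) := by
  have hf : FixesCompound (LTerm.inst r) := fun _ _ => rfl
  have := congrArg (LFormula.map (LTerm.inst r) (LTerm.inst r)) h
  rwa [map_tr hf hf, map_tr hf hf, inst_comp_bindEnv, inst_comp_bindEnv] at this

/-- Equality of readings is checked argument by argument. The free occurrences of `x` outside the
modal operators receive `r` on both sides, and nothing else changes. -/
theorem Formula.tr_update_congr {A : Formula ar} {ρ₁ ρ₂ ρ₁' ρ₂' : ℕ → LTerm}
    (h : A.tr ρ₁ ρ₂ = A.tr ρ₁' ρ₂') (x : ℕ) (r : LTerm) :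
    A.tr (Function.update ρ₁ x r) ρ₂ = A.tr (Function.update ρ₁' x r) ρ₂' := by
  have ht (ρ ρ' : ℕ → LTerm) (t : Term) (h : t.eval ρ = t.eval ρ') :
      t.eval (Function.update ρ x r) = t.eval (Function.update ρ' x r) := by
    cases t with
    | var n =>
      by_cases hn : n = x
      · subst hn; simp [Term.eval]
      · simpa [Term.eval, hn] using h
    | _ => rfl
  induction A generalizing ρ₁ ρ₂ ρ₁' ρ₂' r with
  | bot => rfl
  | eq t s =>
    simp only [tr, LFormula.eq.injEq] at h ⊢
    exact ⟨ht _ _ _ h.1, ht _ _ _ h.2⟩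
  | pred P ts =>
    simp only [tr, LFormula.pred.injEq, heq_eq_eq, true_and] at h ⊢
    exact funext fun i => ht _ _ _ (congrFun h i)
  | imp A B ihA ihB =>
    simp only [tr, LFormula.imp.injEq] at h ⊢
    exact ⟨ihA h.1 r ht, ihB h.2 r ht⟩
  | and A B ihA ihB =>
    simp only [tr, LFormula.and.injEq] at h ⊢
    exact ⟨ihA h.1 r ht, ihB h.2 r ht⟩
  | all y A ih =>
    simp only [tr, LFormula.all.injEq] at h ⊢
    by_cases hy : x = y
    · subst hy
      simpa only [bindEnv_update_self] using h
    · rw [bindEnv_update hy, bindEnv_update hy]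
      refine ih h _ fun ρ ρ' t h => ?_
      cases t with
      | var n =>
        by_cases hn : n = x
        · subst hn; simp [Term.eval]
        · simpa [Term.eval, hn] using h
      | _ => rfl
  | know a A ih => exact h
  | just j A ih => exact h

/-! ### Existence of substitution results -/

namespace Formula

/-- The number of logical symbols. -/
def size : Formula ar → ℕ
  | bot => 0
  | eq _ _ => 0
  | pred _ _ => 0
  | imp A B => A.size + B.size + 1
  | and A B => A.size + B.size + 1
  | all _ A => A.size + 1
  | know _ A => A.size + 1
  | just _ A => A.size + 1

end Formula

theorem Subst.size_eq {l : List (ℕ × Term)} {A B : Formula ar} (h : Subst l A B) :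
    B.size = A.size := by
  induction h <;> simp_all [Formula.size]

theorem exists_subst (l : List (ℕ × Term)) (A : Formula ar) : ∃ B, Subst l A B := by
  induction hn : A.size using Nat.strong_induction_on generalizing A l with
  | _ n ih =>
  subst hn
  cases A with
  | bot => exact ⟨_, .bot l⟩
  | eq t s => exact ⟨_, .eq l t s⟩
  | pred P ts => exact ⟨_, .pred l P ts⟩
  | imp A B =>
    obtain ⟨A', hA⟩ := ih A.size (by simp only [Formula.size]; omega) l A rfl
    obtain ⟨B', hB⟩ := ih B.size (by simp only [Formula.size]; omega) l B rfl
    exact ⟨_, .imp hA hB⟩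
  | and A B =>
    obtain ⟨A', hA⟩ := ih A.size (by simp only [Formula.size]; omega) l A rfl
    obtain ⟨B', hB⟩ := ih B.size (by simp only [Formula.size]; omega) l B rfl
    exact ⟨_, .and hA hB⟩
  | know a A =>
    obtain ⟨A', hA⟩ := ih A.size (by simp only [Formula.size]; omega) l A rfl
    exact ⟨_, .know hA⟩
  | just j A =>
    obtain ⟨A', hA⟩ := ih A.size (by simp only [Formula.size]; omega) l A rfl
    exact ⟨_, .just hA⟩
  | all y A =>
    by_cases hy : ∃ p ∈ l.filter (fun p => p.1 ≠ y), p.2 = .var y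
    · obtain ⟨z, hz⟩ := Infinite.exists_notMem_finset (A.occurring ∪
        ((l.map Prod.fst).toFinset ∪ (l.map fun p => p.2.asVar).foldr (· ∪ ·) ∅))
      simp only [Finset.mem_union, not_or, List.mem_toFinset] at hz
      obtain ⟨A', hA⟩ := ih A.size (by simp only [Formula.size]; omega) [(y, .var z)] A rfl
      -- The renamed formula `A'` is not a subformula, hence the induction on size, which
      -- substitution preserves.
      obtain ⟨A'', hA'⟩ := ih A'.size (by rw [hA.size_eq]; simp only [Formula.size]; omega)
        (l.filter fun p => p.1 ≠ y) A' rfl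
      refine ⟨_, .all_rename rfl hy hz.1 (fun p hp => ?_) hA hA'⟩
      have hp := (List.mem_filter.1 hp).1
      refine ⟨fun e => hz.2.1 (e ▸ List.mem_map_of_mem hp), fun e => hz.2.2 ?_⟩
      have hfold : ∀ L : List (Finset ℕ), {z} ∈ L → z ∈ L.foldr (· ∪ ·) ∅ := fun L => by
        induction L with
        | nil => simp
        | cons S L ih =>
          simp only [List.mem_cons, List.foldr_cons, Finset.mem_union]
          exact Or.imp (fun h => h ▸ Finset.mem_singleton_self z) ih
      exact hfold _ (List.mem_map.2 ⟨p, hp, by rw [e, Term.asVar]⟩)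
    · push Not at hy
      obtain ⟨A', hA⟩ := ih A.size (by simp only [Formula.size]; omega)
        (l.filter fun p => p.1 ≠ y) A rfl
      exact ⟨_, .all_keep rfl hy hA⟩

theorem exists_idSubst (u : Term) (v : ℕ) (A : Formula ar) : ∃ B, IdSubst u v A B := by
  induction hn : A.size using Nat.strong_induction_on generalizing A with
  | _ n ih =>
  subst hn
  cases A with
  | bot => exact ⟨_, .bot⟩
  | eq t s => exact ⟨_, .eq t s⟩
  | pred P ts => exact ⟨_, .pred P ts⟩
  | imp A B =>
    obtain ⟨A', hA⟩ := ih A.size (by simp only [Formula.size]; omega) A rfl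
    obtain ⟨B', hB⟩ := ih B.size (by simp only [Formula.size]; omega) B rfl
    exact ⟨_, .imp hA hB⟩
  | and A B =>
    obtain ⟨A', hA⟩ := ih A.size (by simp only [Formula.size]; omega) A rfl
    obtain ⟨B', hB⟩ := ih B.size (by simp only [Formula.size]; omega) B rfl
    exact ⟨_, .and hA hB⟩
  | know a A => exact ⟨_, .know a A⟩
  | just j A => exact ⟨_, .just j A⟩
  | all y A =>
    by_cases hv : v = y
    · subst hv; exact ⟨_, .all_same A⟩
    by_cases hu : u = .var y
    · obtain ⟨z, hz⟩ := Infinite.exists_notMem_finset (A.occurring ∪ {y, v})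
      simp only [Finset.mem_union, not_or, Finset.mem_insert, Finset.mem_singleton] at hz
      obtain ⟨A', hA⟩ := exists_subst [(y, .var z)] A
      obtain ⟨A'', hA'⟩ := ih A'.size (by rw [hA.size_eq]; simp only [Formula.size]; omega) A' rfl
      refine ⟨_, .all_rename hv hu hz.1 (fun e => ?_) (Ne.symm hz.2.2) hA hA'⟩
      rw [hu] at e
      exact hz.2.1 (Term.var.inj e).symm
    · obtain ⟨A', hA⟩ := ih A.size (by simp only [Formula.size]; omega) A rfl
      exact ⟨_, .all_keep hv hu hA⟩

theorem lookup_map_mk (σ : ℕ → Term) {l : List ℕ} {x : ℕ} (h : x ∈ l) :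
    (l.map fun x => (x, σ x)).lookup x = some (σ x) := by
  induction l with
  | nil => simp at h
  | cons y l ih =>
    by_cases hy : x = y
    · subst hy; simp
    · rw [List.map_cons, List.lookup_cons, beq_eq_false_iff_ne.2 hy]
      exact ih ((List.mem_cons.1 h).resolve_left hy)

theorem exists_cls_eq (σ : ℕ → Term) (A : Formula ar) :
    ∃ B : Formula ar, B.cls = A.tr (fun n => .free (σ n)) (fun n => .free (σ n)) := by
  obtain ⟨B, hB⟩ := exists_subst (A.freeVars.toList.map fun x => (x, σ x)) A
  refine ⟨B, (hB.tr_eq _ _).trans ?_⟩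
  have key : ∀ x ∈ A.freeVars, substEnv (A.freeVars.toList.map fun x => (x, σ x))
      (fun n => .free (.var n)) x = .free (σ x) := fun x hx => by
    simp only [substEnv, Term.replace, lookup_map_mk σ (Finset.mem_toList.2 hx), Option.getD_some]
    cases σ x <;> rfl
  exact Formula.tr_congr key key

theorem Term.replace_of_id {l : List (ℕ × Term)} (h : ∀ p ∈ l, p.2 = .var p.1) (t : Term) :
    t.replace l = t := by
  cases t with
  | var n =>
    cases hn : l.lookup n with
    | none => simp [Term.replace, hn]
    | some t => simpa [Term.replace, hn] using h _ (mem_of_lookup hn)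
  | _ => rfl

theorem Subst.of_id {l : List (ℕ × Term)} (h : ∀ p ∈ l, p.2 = .var p.1) (A : Formula ar) :
    Subst l A A := by
  induction A generalizing l with
  | bot => exact .bot l
  | eq t s => simpa only [Term.replace_of_id h] using Subst.eq (ar := ar) l t s
  | pred P ts => simpa only [Term.replace_of_id h] using Subst.pred (ar := ar) l P ts
  | imp A B ihA ihB => exact .imp (ihA h) (ihB h)
  | and A B ihA ihB => exact .and (ihA h) (ihB h)
  | know a A ih => exact .know (ih h)
  | just j A ih => exact .just (ih h)
  | all y A ih =>
    refine .all_keep rfl (fun p hp => ?_) (ih fun p hp => h p (List.mem_filter.1 hp).1)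
    obtain ⟨hp, hy⟩ := List.mem_filter.1 hp
    rw [h p hp]
    exact fun e => (by simpa using hy : p.1 ≠ y) (Term.var.inj e)

theorem Subst.refl_var (x : ℕ) (A : Formula ar) : Subst [(x, .var x)] A A :=
  .of_id (by simp) A

/-! ### Renaming without regard to quantifiers -/

/-- `t` with the variable `n` replaced by `σ n`, if `t` is a variable. -/
def Term.subst (σ : ℕ → Term) : Term → Term
  | var n => σ n
  | app t s => app t s
  | lam n t => lam n t
  | bang t => bang t

theorem Term.subst_subst (σ τ : ℕ → Term) (t : Term) :
    (t.subst σ).subst τ = t.subst fun n => (σ n).subst τ := by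
  cases t <;> rfl

theorem Term.subst_congr {σ τ : ℕ → Term} {t : Term} (h : ∀ x ∈ t.asVar, σ x = τ x) :
    t.subst σ = t.subst τ := by
  cases t <;> simp_all [Term.subst, Term.asVar]

theorem Term.subst_var (t : Term) : t.subst Term.var = t := by
  cases t <;> rfl

theorem Term.mem_asVar_subst {σ : ℕ → Term} {t : Term} {y : ℕ} (h : y ∈ (t.subst σ).asVar) :
    ∃ x ∈ t.asVar, y ∈ (σ x).asVar := by
  cases t <;> simp_all [Term.subst, Term.asVar]

theorem Term.replace_singleton (x : ℕ) (u t : Term) :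
    t.replace [(x, u)] = t.subst (Function.update Term.var x u) := by
  cases t with
  | var n =>
    by_cases h : n = x
    · subst h; simp [Term.replace, Term.subst]
    · simp [Term.replace, Term.subst, h, List.lookup_cons, beq_eq_false_iff_ne.2 h]
  | _ => rfl

namespace Formula

/-- Replacement of all occurrences of variables in atomic subformulae, free or bound. -/
def raw (σ : ℕ → Term) : Formula ar → Formula ar
  | bot => bot
  | eq t s => eq (t.subst σ) (s.subst σ)
  | pred P ts => pred P fun i => (ts i).subst σ
  | imp A B => imp (A.raw σ) (B.raw σ)
  | and A B => and (A.raw σ) (B.raw σ)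
  | all x A => all x (A.raw σ)
  | know a A => know a (A.raw σ)
  | just j A => just j (A.raw σ)

theorem raw_raw (σ τ : ℕ → Term) (A : Formula ar) :
    (A.raw σ).raw τ = A.raw fun n => (σ n).subst τ := by
  induction A <;> simp_all [raw, Term.subst_subst]

theorem raw_var (A : Formula ar) : A.raw Term.var = A := by
  induction A <;> simp_all [raw, Term.subst_var]

theorem raw_congr {σ τ : ℕ → Term} {A : Formula ar} (h : ∀ x ∈ A.occurring, σ x = τ x) :
    A.raw σ = A.raw τ := by
  induction A with
  | bot => rfl
  | eq t s =>
    simp only [occurring, Finset.mem_union] at h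
    simp only [raw, Term.subst_congr fun x hx => h x (.inl hx),
      Term.subst_congr fun x hx => h x (.inr hx)]
  | pred P ts =>
    simp only [occurring, Finset.mem_biUnion, Finset.mem_univ, true_and] at h
    simp only [raw, fun i => Term.subst_congr (t := ts i) fun x hx => h x ⟨i, hx⟩]
  | imp A B ihA ihB =>
    simp only [occurring, Finset.mem_union] at h
    simp only [raw, ihA fun x hx => h x (.inl hx), ihB fun x hx => h x (.inr hx)]
  | and A B ihA ihB =>
    simp only [occurring, Finset.mem_union] at h
    simp only [raw, ihA fun x hx => h x (.inl hx), ihB fun x hx => h x (.inr hx)]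
  | all y A ih => simp only [raw, ih h]
  | know a A ih => simp only [raw, ih h]
  | just j A ih => simp only [raw, ih h]

theorem quantified_raw (σ : ℕ → Term) (A : Formula ar) : (A.raw σ).quantified = A.quantified := by
  induction A <;> simp_all [raw, quantified]

theorem mem_occurring_raw {σ : ℕ → Term} {A : Formula ar} {y : ℕ}
    (h : y ∈ (A.raw σ).occurring) : ∃ x ∈ A.occurring, y ∈ (σ x).asVar := by
  induction A with
  | bot => simp [raw, occurring] at h
  | eq t s =>
    simp only [raw, occurring, Finset.mem_union] at h ⊢
    rcases h with h | h
    · obtain ⟨x, hx, hy⟩ := Term.mem_asVar_subst h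
      exact ⟨x, .inl hx, hy⟩
    · obtain ⟨x, hx, hy⟩ := Term.mem_asVar_subst h
      exact ⟨x, .inr hx, hy⟩
  | pred P ts =>
    simp only [raw, occurring, Finset.mem_biUnion, Finset.mem_univ, true_and] at h ⊢
    obtain ⟨i, h⟩ := h
    obtain ⟨x, hx, hy⟩ := Term.mem_asVar_subst h
    exact ⟨x, ⟨i, hx⟩, hy⟩
  | imp A B ihA ihB =>
    simp only [raw, occurring, Finset.mem_union] at h ⊢
    rcases h with h | h
    · obtain ⟨x, hx, hy⟩ := ihA h
      exact ⟨x, .inl hx, hy⟩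
    · obtain ⟨x, hx, hy⟩ := ihB h
      exact ⟨x, .inr hx, hy⟩
  | and A B ihA ihB =>
    simp only [raw, occurring, Finset.mem_union] at h ⊢
    rcases h with h | h
    · obtain ⟨x, hx, hy⟩ := ihA h
      exact ⟨x, .inl hx, hy⟩
    · obtain ⟨x, hx, hy⟩ := ihB h
      exact ⟨x, .inr hx, hy⟩
  | all z A ih => exact ih h
  | know a A ih => exact ih h
  | just j A ih => exact ih h

theorem subst_raw {x y : ℕ} {A : Formula ar} (hx : x ∉ A.quantified) (hy : y ∉ A.quantified) :
    Subst [(x, .var y)] A (A.raw (Function.update Term.var x (.var y))) := by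
  induction A with
  | bot => exact .bot _
  | eq t s =>
    simpa only [raw, Term.replace_singleton] using Subst.eq (ar := ar) [(x, .var y)] t s
  | pred P ts =>
    simpa only [raw, Term.replace_singleton] using Subst.pred (ar := ar) [(x, .var y)] P ts
  | imp A B ihA ihB =>
    simp only [quantified, Finset.mem_union, not_or] at hx hy
    exact .imp (ihA hx.1 hy.1) (ihB hx.2 hy.2)
  | and A B ihA ihB =>
    simp only [quantified, Finset.mem_union, not_or] at hx hy
    exact .and (ihA hx.1 hy.1) (ihB hx.2 hy.2)
  | know a A ih => exact .know (ih hx hy)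
  | just j A ih => exact .just (ih hx hy)
  | all z A ih =>
    simp only [quantified, Finset.mem_insert, not_or] at hx hy
    refine .all_keep (l' := [(x, .var y)]) (by simp [hx.1]) ?_ (ih hx.2 hy.2)
    simpa using hy.1

theorem subst_fresh {x y : ℕ} {A : Formula ar} (hx : x ∉ A.quantified) (hy : y ∉ A.quantified)
    (hxo : x ∉ A.occurring) : Subst [(x, .var y)] A A := by
  have : A.raw (Function.update Term.var x (.var y)) = A := by
    refine (raw_congr (τ := Term.var) fun n hn => ?_).trans (raw_var A)
    rw [Function.update_of_ne]
    exact fun e => hxo (e ▸ hn)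
  simpa only [this] using subst_raw hx hy

end Formula

/-! ### Renaming bound variables -/

/-- `A` and `B` are results of one and the same substitution. -/
def Variant (A B : Formula ar) : Prop :=
  ∃ F : Finset ℕ, ∀ x ∉ F, ∀ y ∉ F, x ≠ y →
    ∃ C, Subst [(x, .var y)] C A ∧ Subst [(x, .var y)] C B

namespace Variant

theorem symm {A B : Formula ar} : Variant A B → Variant B A := fun ⟨F, h⟩ =>
  ⟨F, fun x hx y hy hxy => let ⟨C, hA, hB⟩ := h x hx y hy hxy; ⟨C, hB, hA⟩⟩

theorem refl (A : Formula ar) : Variant A A := by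
  refine ⟨A.occurring ∪ A.quantified, fun x hx y hy _ => ?_⟩
  simp only [Finset.mem_union, not_or] at hx hy
  have := Formula.subst_fresh hx.2 hy.2 hx.1
  exact ⟨A, this, this⟩

theorem imp {A A' B B' : Formula ar} : Variant A A' → Variant B B' →
    Variant (A.imp B) (A'.imp B') := fun ⟨F, h⟩ ⟨F', h'⟩ => by
  -- Both sides need the same `x` and `y`; this is possible because almost all pairs are admitted.
  refine ⟨F ∪ F', fun x hx y hy hxy => ?_⟩
  simp only [Finset.mem_union, not_or] at hx hy
  obtain ⟨C, hA, hA'⟩ := h x hx.1 y hy.1 hxy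
  obtain ⟨D, hB, hB'⟩ := h' x hx.2 y hy.2 hxy
  exact ⟨_, .imp hA hB, .imp hA' hB'⟩

theorem and {A A' B B' : Formula ar} : Variant A A' → Variant B B' →
    Variant (A.and B) (A'.and B') := fun ⟨F, h⟩ ⟨F', h'⟩ => by
  refine ⟨F ∪ F', fun x hx y hy hxy => ?_⟩
  simp only [Finset.mem_union, not_or] at hx hy
  obtain ⟨C, hA, hA'⟩ := h x hx.1 y hy.1 hxy
  obtain ⟨D, hB, hB'⟩ := h' x hx.2 y hy.2 hxy
  exact ⟨_, .and hA hB, .and hA' hB'⟩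

theorem know {A A' : Formula ar} (a : ℕ) : Variant A A' → Variant (A.know a) (A'.know a) :=
  fun ⟨F, h⟩ => ⟨F, fun x hx y hy hxy =>
    let ⟨_, hA, hB⟩ := h x hx y hy hxy; ⟨_, .know hA, .know hB⟩⟩

theorem just {A A' : Formula ar} (j : Term) : Variant A A' → Variant (A.just j) (A'.just j) :=
  fun ⟨F, h⟩ => ⟨F, fun x hx y hy hxy =>
    let ⟨_, hA, hB⟩ := h x hx y hy hxy; ⟨_, .just hA, .just hB⟩⟩

theorem all {A A' : Formula ar} (z : ℕ) : Variant A A' → Variant (A.all z) (A'.all z) :=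
  fun ⟨F, h⟩ => by
  refine ⟨insert z F, fun x hx y hy hxy => ?_⟩
  simp only [Finset.mem_insert, not_or] at hx hy
  obtain ⟨C, hA, hB⟩ := h x hx.2 y hy.2 hxy
  have h₁ : [(x, Term.var y)] = [(x, Term.var y)].filter (fun p => p.1 ≠ z) := by simp [hx.1]
  have h₂ : ∀ p ∈ [(x, Term.var y)], p.2 ≠ .var z := by simpa using hy.1
  exact ⟨C.all z, .all_keep h₁ h₂ hA, .all_keep h₁ h₂ hB⟩

/-- Substituting `y` for `x` forces a quantifier over `y` to be renamed even though `x` does not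
occur, and the new variable can be chosen at will. Both `w = v` and a fresh `w` are admissible: `w`
may occur in `A` only as `v`, and those occurrences have become `y`. -/
theorem subst_all_rename {A : Formula ar} {x y v w : ℕ} (hxy : x ≠ y)
    (hx : x ∉ A.occurring) (hx' : x ∉ A.quantified) (hy : y ∉ A.occurring)
    (hy' : y ∉ A.quantified) (hw : w ∉ A.quantified) (hwv : w ∈ A.occurring → w = v)
    (hwx : w ≠ x) (hwy : w ≠ y) :
    Subst [(x, .var y)] ((A.raw (Function.update Term.var v (.var y))).all y)
      ((A.raw (Function.update Term.var v (.var w))).all w) := by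
  have hocc (z u : ℕ) (h : z ∈ (A.raw (Function.update Term.var v (.var u))).occurring) :
      z = u ∨ z ≠ v ∧ z ∈ A.occurring := by
    obtain ⟨n, hn, hz⟩ := Formula.mem_occurring_raw h
    by_cases hnv : n = v
    · subst hnv; simp [Term.asVar] at hz; exact .inl hz
    · simp [hnv, Term.asVar] at hz; subst hz; exact .inr ⟨hnv, hn⟩
  have hraw : (A.raw (Function.update Term.var v (.var y))).raw
      (Function.update Term.var y (.var w)) = A.raw (Function.update Term.var v (.var w)) := by
    rw [Formula.raw_raw]
    refine Formula.raw_congr fun n hn => ?_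
    have hny : n ≠ y := fun e => hy (e ▸ hn)
    by_cases hnv : n = v
    · subst hnv; simp [Term.subst]
    · simp [hnv, hny, Term.subst]
  refine .all_rename (l' := [(x, .var y)]) (by simp [hxy]) (by simp) ?_ ?_
    (A' := A.raw (Function.update Term.var v (.var w))) ?_ ?_
  · intro h
    rcases hocc w y h with h | h
    · exact hwy h
    · exact h.1 (hwv h.2)
  · simp [hwx.symm, hwy.symm]
  · rw [← hraw]
    apply Formula.subst_raw <;> rwa [Formula.quantified_raw]
  · apply Formula.subst_fresh
    · rwa [Formula.quantified_raw]
    · rwa [Formula.quantified_raw]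
    · intro h
      rcases hocc x w h with h | h
      · exact hwx h.symm
      · exact hx h.2

theorem rename {A : Formula ar} {v w : ℕ} (hv : v ∉ A.quantified) (hw : w ∉ A.quantified)
    (hwo : w ∉ A.occurring) :
    Variant (A.all v) ((A.raw (Function.update Term.var v (.var w))).all w) := by
  refine ⟨A.occurring ∪ A.quantified ∪ {v, w}, fun x hx y hy hxy => ?_⟩
  simp only [Finset.mem_union, not_or, Finset.mem_insert, Finset.mem_singleton] at hx hy
  refine ⟨(A.raw (Function.update Term.var v (.var y))).all y, ?_, ?_⟩
  · have := subst_all_rename (v := v) hxy hx.1.1 hx.1.2 hy.1.1 hy.1.2 hv (fun _ => rfl)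
      (Ne.symm hx.2.1) (Ne.symm hy.2.1)
    rwa [Function.update_eq_self_iff.2 rfl, Formula.raw_var] at this
  · exact subst_all_rename hxy hx.1.1 hx.1.2 hy.1.1 hy.1.2 hw (fun h => (hwo h).elim)
      (Ne.symm hx.2.2) (Ne.symm hy.2.2)

/-- Generalise the provable `C → C` over `x` and instantiate at `y`, resolving the first copy of `C`
to `A` and the second to `B`. -/
theorem deriv {A B : Formula ar} : Variant A B → Deriv 0 (A.imp B) := fun ⟨F, h⟩ => by
  obtain ⟨x, hx⟩ := Infinite.exists_notMem_finset F
  obtain ⟨y, hy⟩ := Infinite.exists_notMem_finset (insert x F)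
  simp only [Finset.mem_insert, not_or] at hy
  obtain ⟨C, hA, hB⟩ := h x hx y hy.2 (Ne.symm hy.1)
  refine .all_elim (.imp hA hB) (.all_intro (y := x) (.refl_var x _) (by simp) ?_
    (.imp_intro (.ax C)))
  simp [Formula.freeVars]

end Variant

/-- Equality up to renaming of bound variables. -/
def Alpha (A B : Formula ar) : Prop := Relation.ReflTransGen Variant A B

namespace Alpha

theorem trans {A B C : Formula ar} (h : Alpha A B) (h' : Alpha B C) : Alpha A C :=
  Relation.ReflTransGen.trans h h'

theorem symm {A B : Formula ar} (h : Alpha A B) : Alpha B A := by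
  induction h with
  | refl => exact .refl
  | tail _ h ih => exact .head h.symm ih

theorem lift {f : Formula ar → Formula ar} (hf : ∀ {A B}, Variant A B → Variant (f A) (f B))
    {A B : Formula ar} (h : Alpha A B) : Alpha (f A) (f B) := by
  induction h with
  | refl => exact .refl
  | tail _ h ih => exact .tail ih (hf h)

theorem imp {A A' B B' : Formula ar} (hA : Alpha A A') (hB : Alpha B B') :
    Alpha (A.imp B) (A'.imp B') :=
  (hA.lift (f := fun A => A.imp B) fun h => h.imp (.refl B)).trans
    (hB.lift (f := A'.imp) fun h => (Variant.refl A').imp h)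

theorem and {A A' B B' : Formula ar} (hA : Alpha A A') (hB : Alpha B B') :
    Alpha (A.and B) (A'.and B') :=
  (hA.lift (f := fun A => A.and B) fun h => h.and (.refl B)).trans
    (hB.lift (f := A'.and) fun h => (Variant.refl A').and h)

theorem all {A A' : Formula ar} (x : ℕ) (hA : Alpha A A') : Alpha (A.all x) (A'.all x) :=
  hA.lift fun h => h.all x

theorem know {A A' : Formula ar} (a : ℕ) (hA : Alpha A A') : Alpha (A.know a) (A'.know a) :=
  hA.lift fun h => h.know a

theorem just {A A' : Formula ar} (j : Term) (hA : Alpha A A') : Alpha (A.just j) (A'.just j) :=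
  hA.lift fun h => h.just j

theorem deriv {A B : Formula ar} (h : Alpha A B) : Deriv 0 (A.imp B) := by
  induction h with
  | refl => exact .imp_intro (.ax A)
  | tail _ h ih =>
    have := h.deriv.imp_elim (ih.imp_elim (.ax A))
    exact .imp_intro (by simpa using this)

end Alpha

/-! ### Normal forms -/

/-- The nesting depth of quantifiers. -/
def LFormula.height : LFormula ar → ℕ
  | bot => 0
  | eq _ _ => 0
  | pred _ _ => 0
  | imp A B => max A.height B.height
  | and A B => max A.height B.height
  | all A => A.height + 1
  | know _ A => A.height
  | just _ A => A.height

/-- The term for an argument when the de Bruijn indices are named by `ν`. -/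
def LTerm.name (ν : ℕ → ℕ) : LTerm → Term
  | free t => t
  | bound n => .var (ν n)

theorem LTerm.name_eval (ν : ℕ → ℕ) (ρ : ℕ → LTerm) (t : Term) :
    (t.eval ρ).name ν = t.subst fun n => (ρ n).name ν := by
  cases t <;> rfl

/-- The formula for a nameless formula: a bound variable is `N` plus the height of its range. -/
def LFormula.name (N : ℕ) (ν : ℕ → ℕ) : LFormula ar → Formula ar
  | bot => .bot
  | eq t s => .eq (t.name ν) (s.name ν)
  | pred P ts => .pred P fun i => (ts i).name ν
  | imp A B => .imp (A.name N ν) (B.name N ν)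
  | and A B => .and (A.name N ν) (B.name N ν)
  | all A => .all (N + A.height) (A.name N fun n => n.casesOn (N + A.height) ν)
  | know a A => .know a (A.name N ν)
  | just j A => .just j (A.name N ν)

namespace Formula

/-- The nesting depth of quantifiers. -/
def height : Formula ar → ℕ
  | bot => 0
  | eq _ _ => 0
  | pred _ _ => 0
  | imp A B => max A.height B.height
  | and A B => max A.height B.height
  | all _ A => A.height + 1
  | know _ A => A.height
  | just _ A => A.height

theorem height_tr (A : Formula ar) (ρ₁ ρ₂ : ℕ → LTerm) : (A.tr ρ₁ ρ₂).height = A.height := by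
  induction A generalizing ρ₁ ρ₂ <;> simp_all [tr, height, LFormula.height]

/-- The variant in which a bound variable is `N` plus the height of its range. -/
def normal (N : ℕ) : Formula ar → Formula ar
  | bot => bot
  | eq t s => eq t s
  | pred P ts => pred P ts
  | imp A B => imp (A.normal N) (B.normal N)
  | and A B => and (A.normal N) (B.normal N)
  | all x A => all (N + A.height)
      ((A.normal N).raw (Function.update Term.var x (.var (N + A.height))))
  | know a A => know a (A.normal N)
  | just j A => just j (A.normal N)

/-- For the identity environment this shows that `A.normal N` depends only on the class of `A`. The
condition on `ρ` protects the names from `N` upwards that normalisation introduces; it survives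
quantifiers since these bind variables below `N`. -/
theorem name_tr {N : ℕ} {A : Formula ar} (hA : ∀ x ∈ A.quantified, x < N) {ρ : ℕ → LTerm}
    (hρ : ∀ n, N ≤ n → ρ n = .free (.var n)) (ν : ℕ → ℕ) :
    (A.tr ρ ρ).name N ν = (A.normal N).raw fun n => (ρ n).name ν := by
  induction A generalizing ρ ν with
  | bot => rfl
  | eq t s => simp only [tr, LFormula.name, normal, raw, LTerm.name_eval]
  | pred P ts => simp only [tr, LFormula.name, normal, raw, LTerm.name_eval]
  | imp A B ihA ihB =>
    simp only [quantified, Finset.mem_union] at hA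
    simp only [tr, LFormula.name, normal, raw, ihA (fun x hx => hA x (.inl hx)) hρ,
      ihB (fun x hx => hA x (.inr hx)) hρ]
  | and A B ihA ihB =>
    simp only [quantified, Finset.mem_union] at hA
    simp only [tr, LFormula.name, normal, raw, ihA (fun x hx => hA x (.inl hx)) hρ,
      ihB (fun x hx => hA x (.inr hx)) hρ]
  | know a A ih => simp only [tr, LFormula.name, normal, raw, ih hA hρ]
  | just j A ih => simp only [tr, LFormula.name, normal, raw, ih hA hρ]
  | all x A ih =>
    simp only [quantified, Finset.mem_insert, forall_eq_or_imp] at hA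
    have hb : ∀ n, N ≤ n → bindEnv x ρ n = .free (.var n) := fun n hn => by
      have : n ≠ x := by omega
      simp [bindEnv, this, hρ n hn, LTerm.shift]
    simp only [tr, LFormula.name, normal, raw, ih hA.2 hb, height_tr, raw_raw]
    refine congrArg _ (raw_congr fun n _ => ?_)
    by_cases hn : n = x
    · subst hn; simp [bindEnv, LTerm.name, Term.subst, hρ]
    · cases h : ρ n <;> simp [bindEnv, hn, h, Term.subst, LTerm.shift, LTerm.name]

theorem quantified_normal {N : ℕ} {A : Formula ar} {x : ℕ} (h : x ∈ (A.normal N).quantified) :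
    N ≤ x ∧ x < N + A.height := by
  induction A with
  | imp A B ihA ihB =>
    simp only [normal, quantified, Finset.mem_union, height] at h ⊢
    rcases h with h | h
    · have := ihA h; omega
    · have := ihB h; omega
  | and A B ihA ihB =>
    simp only [normal, quantified, Finset.mem_union, height] at h ⊢
    rcases h with h | h
    · have := ihA h; omega
    · have := ihB h; omega
  | all y A ih =>
    simp only [normal, quantified, Finset.mem_insert, height, quantified_raw] at h ⊢
    rcases h with h | h
    · omega
    · have := ih h; omega
  | know a A ih => exact ih h
  | just j A ih => exact ih h
  | _ => simp [normal, quantified] at h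

theorem occurring_normal {N : ℕ} {A : Formula ar} (hA : ∀ x ∈ A.occurring, x < N) {x : ℕ}
    (h : x ∈ (A.normal N).occurring) : x < N + A.height := by
  induction A generalizing x with
  | imp A B ihA ihB =>
    simp only [normal, occurring, Finset.mem_union, height] at h hA ⊢
    rcases h with h | h
    · have := ihA (fun x hx => hA x (.inl hx)) h; omega
    · have := ihB (fun x hx => hA x (.inr hx)) h; omega
  | and A B ihA ihB =>
    simp only [normal, occurring, Finset.mem_union, height] at h hA ⊢
    rcases h with h | h
    · have := ihA (fun x hx => hA x (.inl hx)) h; omega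
    · have := ihB (fun x hx => hA x (.inr hx)) h; omega
  | all y A ih =>
    obtain ⟨n, hn, hx⟩ := mem_occurring_raw h
    have := ih hA hn
    simp only [height]
    by_cases hny : n = y
    · subst hny; simp [Term.asVar] at hx; omega
    · simp [hny, Term.asVar] at hx; omega
  | know a A ih => exact ih hA h
  | just j A ih => exact ih hA h
  | _ => have := hA x h; omega

/-- Names are given by height, from the inside out: `N` plus the height of the range exceeds every
variable occurring or bound in the normalised range, so `Variant.rename` applies. -/
theorem alpha_normal {N : ℕ} {A : Formula ar} (ho : ∀ x ∈ A.occurring, x < N)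
    (hq : ∀ x ∈ A.quantified, x < N) : Alpha A (A.normal N) := by
  induction A with
  | imp A B ihA ihB =>
    simp only [occurring, quantified, Finset.mem_union] at ho hq
    exact .imp (ihA (fun x hx => ho x (.inl hx)) fun x hx => hq x (.inl hx))
      (ihB (fun x hx => ho x (.inr hx)) fun x hx => hq x (.inr hx))
  | and A B ihA ihB =>
    simp only [occurring, quantified, Finset.mem_union] at ho hq
    exact .and (ihA (fun x hx => ho x (.inl hx)) fun x hx => hq x (.inl hx))
      (ihB (fun x hx => ho x (.inr hx)) fun x hx => hq x (.inr hx))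
  | know a A ih => exact (ih ho hq).know a
  | just j A ih => exact (ih ho hq).just j
  | all y A ih =>
    simp only [quantified, Finset.mem_insert, forall_eq_or_imp] at hq
    refine ((ih ho hq.2).all y).tail (Variant.rename (fun h => ?_) (fun h => ?_) fun h => ?_)
    · have := quantified_normal h; omega
    · have := quantified_normal h; omega
    · have := occurring_normal (A := A) ho h; omega
  | _ => exact .refl

theorem deriv_imp_of_cls_eq {A B : Formula ar} (h : A.cls = B.cls) : Deriv 0 (A.imp B) := by
  obtain ⟨N, hN⟩ :=
    (A.occurring ∪ A.quantified ∪ (B.occurring ∪ B.quantified)).exists_nat_subset_range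
  have hlt : ∀ x, (x ∈ A.occurring ∨ x ∈ A.quantified) ∨ (x ∈ B.occurring ∨ x ∈ B.quantified) →
      x < N := fun x hx => Finset.mem_range.1 (hN (by simpa only [Finset.mem_union] using hx))
  have hnorm (C : Formula ar) (hC : ∀ x ∈ C.quantified, x < N) :
      C.cls.name N id = C.normal N :=
    (name_tr hC (fun _ _ => rfl) id).trans (raw_var _)
  have hA := alpha_normal (A := A) (N := N) (fun x hx => hlt x (.inl (.inl hx)))
    (fun x hx => hlt x (.inl (.inr hx)))
  have hB := alpha_normal (A := B) (N := N) (fun x hx => hlt x (.inr (.inl hx)))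
    (fun x hx => hlt x (.inr (.inr hx)))
  have : A.normal N = B.normal N := by
    rw [← hnorm A fun x hx => hlt x (.inl (.inr hx)), h,
      hnorm B fun x hx => hlt x (.inr (.inr hx))]
  rw [this] at hA
  exact (hA.trans hB.symm).deriv

end Formula

/-! ### Derivability from sets of formulae -/

/-- This allows all copies of an assumption to be discharged at once; `n = 0` is weakening, larger
`n` contraction. -/
theorem Deriv.of_replicate {Γ : Multiset (Formula ar)} {A B : Formula ar} {n : ℕ}
    (h : Deriv (Multiset.replicate n A + Γ) B) : Deriv (A ::ₘ Γ) B := by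
  induction n with
  | zero => exact (show Deriv Γ B by simpa using h).weaken
  | succ n ih =>
    cases n with
    | zero => simpa using h
    | succ n =>
      simp only [Multiset.replicate_succ, Multiset.cons_add] at h ih
      exact ih h.contract

namespace Derivable

variable {S T : Set (Formula ar)} {A B : Formula ar}

theorem of_deriv (h : Deriv 0 A) : Derivable S A := ⟨0, by simp, h⟩

theorem of_mem (h : A ∈ S) : Derivable S A := ⟨{A}, by simpa using h, .ax A⟩

theorem mono (h : S ⊆ T) : Derivable S A → Derivable T A := fun ⟨Γ, hΓ, hA⟩ =>
  ⟨Γ, fun G hG => h (hΓ G hG), hA⟩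

theorem add_mem {Γ Δ : Multiset (Formula ar)} (hΓ : ∀ G ∈ Γ, G ∈ S) (hΔ : ∀ G ∈ Δ, G ∈ S) :
    ∀ G ∈ Γ + Δ, G ∈ S := fun G hG => (Multiset.mem_add.1 hG).elim (hΓ G) (hΔ G)

theorem mp : Derivable S (A.imp B) → Derivable S A → Derivable S B :=
  fun ⟨_, hΓ, h⟩ ⟨_, hΔ, h'⟩ => ⟨_, add_mem hΓ hΔ, h.imp_elim h'⟩

theorem neg_elim (h : Derivable S A.neg) (h' : Derivable S A) : Derivable S .bot := mp h h'

theorem intro : Derivable (insert A S) B → Derivable S (A.imp B) := fun ⟨Γ, hΓ, h⟩ => by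
  classical
  refine ⟨Γ.filter (fun G => ¬G = A), fun G hG => ?_, .imp_intro (.of_replicate (n := Γ.count A) ?_)⟩
  · obtain ⟨hG, hne⟩ := Multiset.mem_filter.1 hG
    exact (hΓ G hG).resolve_left hne
  · rwa [← Multiset.filter_eq', Multiset.filter_add_not]

theorem neg_neg : Derivable S A.neg.neg → Derivable S A := fun ⟨Γ, hΓ, h⟩ =>
  ⟨Γ, hΓ, h.neg_neg_elim⟩

theorem bot_elim (h : Derivable S .bot) : Derivable S A :=
  neg_neg (intro (h.mono (Set.subset_insert _ _)))

theorem by_contra (h : Derivable (insert A.neg S) .bot) : Derivable S A := neg_neg (intro h)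

theorem and_intro : Derivable S A → Derivable S B → Derivable S (A.and B) :=
  fun ⟨_, hΓ, h⟩ ⟨_, hΔ, h'⟩ => ⟨_, add_mem hΓ hΔ, h.and_intro h'⟩

theorem and_left : Derivable S (A.and B) → Derivable S A := fun ⟨Γ, hΓ, h⟩ => ⟨Γ, hΓ, h.and_left⟩

theorem and_right : Derivable S (A.and B) → Derivable S B :=
  fun ⟨Γ, hΓ, h⟩ => ⟨Γ, hΓ, h.and_right⟩

theorem all_intro {x y : ℕ} (hAB : Subst [(x, .var y)] A B) (hS : ∀ G ∈ S, y ∉ G.freeVars)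
    (hA : y ∉ (A.all x).freeVars) : Derivable S B → Derivable S (A.all x) :=
  fun ⟨Γ, hΓ, h⟩ => ⟨Γ, hΓ, .all_intro hAB (fun G hG => hS G (hΓ G hG)) hA h⟩

theorem all_elim {x : ℕ} {t : Term} (hAB : Subst [(x, t)] A B) :
    Derivable S (A.all x) → Derivable S B := fun ⟨Γ, hΓ, h⟩ => ⟨Γ, hΓ, h.all_elim hAB⟩

theorem cut_multiset {Γ : Multiset (Formula ar)} (hΓ : ∀ G ∈ Γ, Derivable S G) (h : Deriv Γ A) :
    Derivable S A := by
  induction Γ using Multiset.induction generalizing A with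
  | empty => exact of_deriv h
  | cons B Γ ih =>
    simp only [Multiset.mem_cons, forall_eq_or_imp] at hΓ
    exact (ih hΓ.2 h.imp_intro).mp hΓ.1

theorem cut (hT : ∀ B ∈ T, Derivable S B) : Derivable T A → Derivable S A :=
  fun ⟨_, hΓ, h⟩ => cut_multiset (fun G hG => hT G (hΓ G hG)) h

theorem of_cls_eq (h : Derivable S A) (hAB : A.cls = B.cls) : Derivable S B :=
  (of_deriv (Formula.deriv_imp_of_cls_eq hAB)).mp h

theorem of_neg_imp (h : Derivable S (A.imp B).neg) : Derivable S A ∧ Derivable S B.neg := by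
  refine ⟨by_contra ?_, intro ?_⟩
  · refine (h.mono (Set.subset_insert _ _)).mp (intro (bot_elim ?_))
    exact neg_elim (A := A) (of_mem (by simp)) (of_mem (by simp))
  · exact (h.mono (Set.subset_insert _ _)).mp (intro (of_mem (by simp)))

theorem insert_and {C : Formula ar} (h : Derivable (insert (A.and B) S) C) :
    Derivable (insert B (insert A S)) C := by
  refine cut (fun G hG => ?_) h
  rcases hG with rfl | hG
  · exact and_intro (of_mem (by simp)) (of_mem (by simp))
  · exact of_mem (by simp [hG])

theorem know_intro {a : ℕ} : Derivable S A → Derivable (Formula.know a '' S) (A.know a) :=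
  fun ⟨Γ, hΓ, h⟩ => by
  have hmem : ∀ G ∈ Γ.map (Formula.know a), G ∈ Formula.know a '' S := fun G hG => by
    obtain ⟨B, hB, rfl⟩ := Multiset.mem_map.1 hG
    exact ⟨B, hΓ B hB, rfl⟩
  obtain ⟨Δ, hΔ, hA⟩ : Derivable {G | G ∈ Γ.map (Formula.know a)} A :=
    cut_multiset (fun G hG =>
      have : Formula.know a G ∈ {G | G ∈ Γ.map (Formula.know a)} := Multiset.mem_map_of_mem _ hG
      let ⟨Δ, hΔ, hG⟩ := of_mem this
      ⟨Δ, hΔ, hG.know_elim⟩) h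
  -- Cutting may have changed multiplicities, so `Δ` has to be recognised again as a multiset of
  -- formulae `K_a B`.
  have hK : ∃ Θ : Multiset (Formula ar), Δ = Θ.map (Formula.know a) := by
    have : ∀ G ∈ Δ, ∃ B, Formula.know a B = G := fun G hG => by
      obtain ⟨B, _, hB⟩ := Multiset.mem_map.1 (hΔ G hG)
      exact ⟨B, hB⟩
    clear hA hΔ
    induction Δ using Multiset.induction with
    | empty => exact ⟨0, by simp⟩
    | cons G Δ ih =>
      simp only [Multiset.mem_cons, forall_eq_or_imp] at this
      obtain ⟨Θ, rfl⟩ := ih this.2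
      obtain ⟨B, rfl⟩ := this.1
      exact ⟨B ::ₘ Θ, by simp⟩
  obtain ⟨Θ, rfl⟩ := hK
  exact ⟨_, fun G hG => hmem G (hΔ G hG), hA.know_intro⟩

theorem necessitation {a : ℕ} (h : Derivable ∅ A) : Derivable S (A.know a) := by
  have := know_intro (a := a) h
  rw [Set.image_empty] at this
  exact this.mono (Set.empty_subset S)

theorem know_mp {a : ℕ} : Derivable S ((A.imp B).know a) → Derivable S (A.know a) →
    Derivable S (B.know a) :=
  fun ⟨_, hΓ, h⟩ ⟨_, hΔ, h'⟩ => ⟨_, add_mem hΓ hΔ, h.know_imp h'⟩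

theorem know_elim {a : ℕ} : Derivable S (A.know a) → Derivable S A :=
  fun ⟨Γ, hΓ, h⟩ => ⟨Γ, hΓ, h.know_elim⟩

theorem know_neg {a : ℕ} : Derivable S (A.know a).neg → Derivable S ((A.know a).neg.know a) :=
  fun ⟨Γ, hΓ, h⟩ => ⟨Γ, hΓ, h.know_neg⟩

theorem know_know {a : ℕ} (h : Derivable S (A.know a)) : Derivable S ((A.know a).know a) := by
  have : Deriv {A.know a} ((A.know a).know a) := by
    simpa using Deriv.know_intro (Γ := {A}) (by simpa using Deriv.ax (A.know a))
  exact cut_multiset (by simpa using h) this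

/-- With `φ = ∀ x. K_a A`, factivity gives `¬K_a ¬φ`, hence `K_a ¬K_a ¬φ`, and it suffices to derive
`A` from `¬K_a ¬φ`, where `x` is not free. If `¬A`, then `¬K_a A`, so `K_a ¬K_a A`; as `¬K_a A`
refutes `φ`, this yields `K_a ¬φ`, a contradiction. -/
theorem barcan {a x : ℕ} (h : Derivable S ((A.know a).all x)) :
    Derivable S ((A.all x).know a) := by
  set φ := (A.know a).all x with hφ
  have h₁ : Derivable S (φ.neg.know a).neg := intro
    (neg_elim (A := φ) (know_elim (a := a) (of_mem (by simp))) (h.mono (Set.subset_insert _ _)))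
  refine know_mp (necessitation (intro ?_)) h₁.know_neg
  refine all_intro (.refl_var x A) (fun G hG => ?_) (by simp [Formula.freeVars]) (by_contra ?_)
  · simp only [insert_empty_eq, Set.mem_singleton_iff] at hG
    simp [hG, hφ, Formula.neg, Formula.freeVars]
  · refine neg_elim (A := φ.neg.know a) (of_mem (by simp)) ?_
    have h₂ : Derivable (insert A.neg (insert (φ.neg.know a).neg ∅)) (A.know a).neg :=
      intro (neg_elim (A := A) (of_mem (by simp)) (know_elim (a := a) (of_mem (by simp))))
    refine know_mp (necessitation (intro (intro ?_))) h₂.know_neg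
    exact neg_elim (A := A.know a) (of_mem (by simp)) (all_elim (.refl_var x _) (of_mem (by simp [hφ])))

/-- A refuted witness formula `B → ∀ x. A` yields both `B` and `¬∀ x. A`; for fresh `y` the former
generalises to `∀ x. A`. -/
theorem bot_of_neg_witness {x y : ℕ} {C : Formula ar} (hAB : Subst [(x, .var y)] A B)
    (hC : ∀ G ∈ S, y ∉ G.freeVars) (hA : y ∉ (A.all x).freeVars)
    (h : Derivable S (B.imp (A.all x)).neg) : Derivable S C :=
  bot_elim (h.of_neg_imp.2.mp (all_intro hAB hC hA h.of_neg_imp.1))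

theorem eq_symm {t s : Term} : Derivable S (.eq t s) → Derivable S (.eq s t) :=
  fun ⟨Γ, hΓ, h⟩ => ⟨Γ, hΓ, h.eq_symm⟩

theorem eq_trans {r t s : Term} : Derivable S (.eq r t) → Derivable S (.eq t s) →
    Derivable S (.eq r s) :=
  fun ⟨_, hΓ, h⟩ ⟨_, hΔ, h'⟩ => ⟨_, add_mem hΓ hΔ, h.eq_trans h'⟩

theorem eq_subst {t s : Term} {x : ℕ} {C : Formula ar} (hB : IdSubst t x A B)
    (hC : IdSubst s x A C) : Derivable S (.eq t s) → Derivable S B → Derivable S C :=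
  fun ⟨_, hΓ, h⟩ ⟨_, hΔ, h'⟩ => ⟨_, add_mem hΓ hΔ, h.eq_subst hB hC h'⟩

theorem just_app {j k : Term} : Derivable S ((A.imp B).just j) → Derivable S (A.just k) →
    Derivable S (B.just (.app j k)) :=
  fun ⟨_, hΓ, h⟩ ⟨_, hΔ, h'⟩ => ⟨_, add_mem hΓ hΔ, h.just_app h'⟩

theorem just_elim {j : Term} : Derivable S (A.just j) → Derivable S A :=
  fun ⟨Γ, hΓ, h⟩ => ⟨Γ, hΓ, h.just_elim⟩

theorem just_bang {j : Term} : Derivable S (A.just j) → Derivable S ((A.just j).just (.bang j)) :=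
  fun ⟨Γ, hΓ, h⟩ => ⟨Γ, hΓ, h.just_bang⟩

theorem just_subst {j k t s : Term} {x : ℕ} {C : Formula ar} (hB : IdSubst t x A B)
    (hC : IdSubst s x A C) : Derivable S (.just k (.eq t s)) → Derivable S (B.just j) →
    Derivable S (C.just j) :=
  fun ⟨_, hΓ, h⟩ ⟨_, hΔ, h'⟩ => ⟨_, add_mem hΓ hΔ, h.just_subst hB hC h'⟩

theorem just_subst_symm {j k t s : Term} {x : ℕ} {C : Formula ar} (hB : IdSubst t x A B)
    (hC : IdSubst s x A C) : Derivable S (.just k (.eq s t)) → Derivable S (B.just j) →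
    Derivable S (C.just j) :=
  fun ⟨_, hΓ, h⟩ ⟨_, hΔ, h'⟩ => ⟨_, add_mem hΓ hΔ, h.just_subst_symm hB hC h'⟩

end Derivable

/-! ### Countability of the language -/

/-- A code for a term. -/
def Term.code : Term → ℕ
  | var n => Nat.pair 0 n
  | app t s => Nat.pair 1 (Nat.pair t.code s.code)
  | lam n t => Nat.pair 2 (Nat.pair n t.code)
  | bang t => Nat.pair 3 t.code

theorem Term.code_injective : Function.Injective Term.code := fun t => by
  induction t with
  | var n => intro s h; cases s <;> simp_all [code]
  | app t s iht ihs =>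
    intro r h
    cases r <;> simp [code] at h
    rw [iht h.1, ihs h.2]
  | lam n t ih =>
    intro r h
    cases r <;> simp [code] at h
    rw [h.1, ih h.2]
  | bang t ih =>
    intro r h
    cases r <;> simp [code] at h
    rw [ih h]

/-- A code for a formula, given codes for the predicate symbols. -/
def Formula.code (p : Pred → ℕ) : Formula ar → ℕ
  | bot => Nat.pair 0 0
  | eq t s => Nat.pair 1 (Nat.pair t.code s.code)
  | pred P ts => Nat.pair 2 (Nat.pair (p P) (Encodable.encode (List.ofFn fun i => (ts i).code)))
  | imp A B => Nat.pair 3 (Nat.pair (A.code p) (B.code p))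
  | and A B => Nat.pair 4 (Nat.pair (A.code p) (B.code p))
  | all x A => Nat.pair 5 (Nat.pair x (A.code p))
  | know a A => Nat.pair 6 (Nat.pair a (A.code p))
  | just j A => Nat.pair 7 (Nat.pair j.code (A.code p))

theorem Formula.code_injective {p : Pred → ℕ} (hp : Function.Injective p) :
    Function.Injective (Formula.code (ar := ar) p) := fun A => by
  induction A with
  | bot => intro B h; cases B <;> simp [code] at h; rfl
  | eq t s =>
    intro B h
    cases B <;> simp [code] at h
    rw [Term.code_injective h.1, Term.code_injective h.2]
  | pred P ts =>
    intro B h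
    cases B with
    | pred Q us =>
      simp only [code, Nat.pair_eq_pair, true_and] at h
      obtain rfl := hp h.1
      have := List.ofFn_injective (Encodable.encode_injective h.2)
      exact congrArg _ (funext fun i => Term.code_injective (congrFun this i))
    | _ => simp [code] at h
  | imp A B ihA ihB =>
    intro C h
    cases C <;> simp [code] at h
    rw [ihA h.1, ihB h.2]
  | and A B ihA ihB =>
    intro C h
    cases C <;> simp [code] at h
    rw [ihA h.1, ihB h.2]
  | all x A ih =>
    intro C h
    cases C <;> simp [code] at h
    rw [h.1, ih h.2]
  | know x A ih =>
    intro C h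
    cases C <;> simp [code] at h
    rw [h.1, ih h.2]
  | just j A ih =>
    intro C h
    cases C <;> simp [code] at h
    rw [Term.code_injective h.1, ih h.2]

instance Formula.countable [Countable Pred] : Countable (Formula ar) :=
  let ⟨_, hp⟩ := exists_injective_nat Pred
  (Formula.code_injective hp).countable

/-! ### Saturated sets -/

/-- The class of the results of `A[t/x]`. -/
def Formula.instCls (A : Formula ar) (x : ℕ) (t : Term) : LFormula ar :=
  A.tr (Function.update (fun n => .free (.var n)) x (.free t))
    (Function.update (fun n => .free (.var n)) x (.free t))

theorem Term.eval_free_var (t : Term) : t.eval (fun n => .free (.var n)) = .free t := by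
  cases t <;> rfl

theorem Subst.cls_eq {x : ℕ} {t : Term} {A B : Formula ar} (h : Subst [(x, t)] A B) :
    B.cls = A.instCls x t := by
  rw [Formula.cls, h.tr_eq, substEnv_singleton, Term.eval_free_var, Formula.instCls]

/-- Maximally consistent sets in which every formula `∀ x. A` has a witness. -/
structure Saturated (w : Set (Formula ar)) : Prop where
  consistent : ¬Derivable w .bot
  total : ∀ A, A ∈ w ∨ A.neg ∈ w
  witness : ∀ (x : ℕ) (A : Formula ar), A.all x ∉ w → ∃ (y : ℕ) (B : Formula ar), B.cls = A.instCls x (.var y) ∧ B ∉ w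

namespace Saturated

variable {w : Set (Formula ar)} {A B : Formula ar}

theorem mem_of_derivable (hw : Saturated w) (h : Derivable w A) : A ∈ w :=
  (hw.total A).resolve_right fun hA => hw.consistent ((Derivable.of_mem hA).mp h)

theorem mem_of_cls_eq (hw : Saturated w) (h : A ∈ w) (hAB : A.cls = B.cls) : B ∈ w :=
  hw.mem_of_derivable ((Derivable.of_mem h).of_cls_eq hAB)

theorem bot_notMem (hw : Saturated w) : Formula.bot ∉ w := fun h =>
  hw.consistent (.of_mem h)

theorem neg_mem_iff (hw : Saturated w) : A.neg ∈ w ↔ A ∉ w :=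
  ⟨fun h h' => hw.consistent ((Derivable.of_mem h).mp (.of_mem h')), (hw.total A).resolve_left⟩

theorem imp_mem_iff (hw : Saturated w) : A.imp B ∈ w ↔ (A ∈ w → B ∈ w) := by
  refine ⟨fun h h' => hw.mem_of_derivable ((Derivable.of_mem h).mp (.of_mem h')), fun h => ?_⟩
  refine hw.mem_of_derivable (.intro ?_)
  by_cases hA : A ∈ w
  · exact .of_mem (by simp [h hA])
  · exact .bot_elim (.mp (A := A) (.of_mem (.inr (hw.neg_mem_iff.2 hA))) (.of_mem (by simp)))

theorem and_mem_iff (hw : Saturated w) : A.and B ∈ w ↔ A ∈ w ∧ B ∈ w :=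
  ⟨fun h => ⟨hw.mem_of_derivable (Derivable.of_mem h).and_left,
    hw.mem_of_derivable (Derivable.of_mem h).and_right⟩,
    fun h => hw.mem_of_derivable (.and_intro (.of_mem h.1) (.of_mem h.2))⟩

end Saturated

/-- Everything added to `T` is kept in one conjunction, so `hT` is needed only for single formulae
`C`. This lets the same construction serve sets with fresh variables and sets of known formulae. -/
theorem exists_saturated_step {T : Set (Formula ar)}
    (hT : ∀ (C : Formula ar) (x : ℕ) (A : Formula ar), ¬Derivable (insert C T) .bot → ∃ (y : ℕ) (B : Formula ar), B.cls = A.instCls x (.var y) ∧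
      ¬Derivable (insert (C.and (B.imp (A.all x))) T) .bot)
    (C e : Formula ar) (hC : ¬Derivable (insert C T) .bot) :
    ∃ C', ¬Derivable (insert C' T) .bot ∧ Derivable (insert C' T) C ∧
      (Derivable (insert C' T) e ∨ Derivable (insert C' T) e.neg) ∧
      ∀ (x : ℕ) (A : Formula ar), e = A.all x → ∃ (y : ℕ) (B : Formula ar), B.cls = A.instCls x (.var y) ∧
        Derivable (insert C' T) (B.imp e) := by
  obtain ⟨C₁, h₁, hC₁, he⟩ : ∃ C₁, ¬Derivable (insert C₁ T) .bot ∧ Derivable (insert C₁ T) C ∧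
      (Derivable (insert C₁ T) e ∨ Derivable (insert C₁ T) e.neg) := by
    by_cases h : Derivable (insert (C.and e) T) .bot
    · refine ⟨C.and e.neg, fun h' => hC ?_, .and_left (.of_mem (Set.mem_insert _ _)),
        .inr (.and_right (B := e.neg) (.of_mem (Set.mem_insert _ _)))⟩
      exact (Derivable.intro h'.insert_and).mp (.intro h.insert_and)
    · exact ⟨_, h, .and_left (.of_mem (Set.mem_insert _ _)),
        .inl (.and_right (.of_mem (Set.mem_insert _ _)))⟩
  by_cases hall : ∃ x A, e = Formula.all x A
  · obtain ⟨x, A, rfl⟩ := hall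
    obtain ⟨y, B, hB, hcon⟩ := hT C₁ x A h₁
    have hcut {D : Formula ar} (hD : Derivable (insert C₁ T) D) :
        Derivable (insert (C₁.and (B.imp (A.all x))) T) D := by
      refine hD.cut fun G hG => ?_
      rcases hG with rfl | hG
      · exact .and_left (.of_mem (Set.mem_insert _ _))
      · exact .of_mem (.inr hG)
    refine ⟨_, hcon, hcut hC₁, he.imp hcut hcut, fun x' A' h => ?_⟩
    cases h
    exact ⟨y, B, hB, .and_right (.of_mem (Set.mem_insert _ _))⟩
  · exact ⟨C₁, h₁, hC₁, he, fun x A h => (hall ⟨x, A, h⟩).elim⟩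

theorem exists_saturated [Countable Pred] {T : Set (Formula ar)}
    (hT : ∀ (C : Formula ar) (x : ℕ) (A : Formula ar), ¬Derivable (insert C T) .bot → ∃ (y : ℕ) (B : Formula ar), B.cls = A.instCls x (.var y) ∧
      ¬Derivable (insert (C.and (B.imp (A.all x))) T) .bot)
    (C₀ : Formula ar) (hC₀ : ¬Derivable (insert C₀ T) .bot) :
    ∃ w, Saturated w ∧ T ⊆ w ∧ C₀ ∈ w := by
  have : Nonempty (Formula ar) := ⟨.bot⟩
  obtain ⟨e, he⟩ := exists_surjective_nat (Formula ar)
  choose next hcon hprev hdec hwit using exists_saturated_step hT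
  let c : ℕ → {C // ¬Derivable (insert C T) .bot} := fun n =>
    n.rec ⟨C₀, hC₀⟩ fun n C => ⟨next C.1 (e n) C.2, hcon C.1 (e n) C.2⟩
  have hsucc (n : ℕ) : (c (n + 1)).1 = next (c n).1 (e n) (c n).2 := rfl
  have hstep {n m : ℕ} (hnm : n ≤ m) {A : Formula ar} (hA : Derivable (insert (c n).1 T) A) :
      Derivable (insert (c m).1 T) A := by
    induction hnm with
    | refl => exact hA
    | step _ ih =>
      refine ih.cut fun G hG => ?_
      rcases hG with rfl | hG
      · exact hprev _ _ _
      · exact .of_mem (.inr hG)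
  let w : Set (Formula ar) := {A | ∃ n, Derivable (insert (c n).1 T) A}
  have hclosed {A : Formula ar} : Derivable w A → A ∈ w := fun ⟨Γ, hΓ, h⟩ => by
    have : ∃ n, ∀ G ∈ Γ, Derivable (insert (c n).1 T) G := by
      clear h
      induction Γ using Multiset.induction with
      | empty => exact ⟨0, by simp⟩
      | cons B Γ ih =>
        simp only [Multiset.mem_cons, forall_eq_or_imp] at hΓ
        obtain ⟨n, hn⟩ := ih hΓ.2
        obtain ⟨m, hm⟩ := hΓ.1
        refine ⟨max n m, fun G hG => ?_⟩
        rcases Multiset.mem_cons.1 hG with rfl | hG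
        · exact hstep (le_max_right n m) hm
        · exact hstep (le_max_left n m) (hn G hG)
    obtain ⟨n, hn⟩ := this
    exact ⟨n, .cut_multiset hn h⟩
  refine ⟨w, ⟨fun h => ?_, fun A => ?_, fun x A hA => ?_⟩, fun A hA => ⟨0, .of_mem (.inr hA)⟩,
    ⟨0, .of_mem (Set.mem_insert _ _)⟩⟩
  · obtain ⟨n, hn⟩ := hclosed h
    exact (c n).2 hn
  · obtain ⟨n, rfl⟩ := he A
    exact (hdec (c n).1 (e n) (c n).2).imp (fun h => ⟨n + 1, h⟩) fun h => ⟨n + 1, h⟩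
  · obtain ⟨n, hn⟩ := he (A.all x)
    obtain ⟨y, B, hB, h⟩ := hwit (c n).1 (e n) (c n).2 x A hn
    refine ⟨y, B, hB, fun hBw => hA (hclosed ?_)⟩
    have h : Derivable (insert (c (n + 1)).1 T) (B.imp (e n)) := h
    rw [hn] at h
    exact .mp (A := B) (.of_mem ⟨n + 1, h⟩) (.of_mem hBw)

theorem exists_saturated_of_infinite [Countable Pred] {T : Set (Formula ar)}
    (hT : {x : ℕ | ∀ G ∈ T, x ∉ G.freeVars}.Infinite) (C₀ : Formula ar)
    (hC₀ : ¬Derivable (insert C₀ T) .bot) : ∃ w, Saturated w ∧ T ⊆ w ∧ C₀ ∈ w := by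
  refine exists_saturated (fun C x A hC => ?_) C₀ hC₀
  obtain ⟨y, hy, hyC⟩ := hT.exists_notMem_finset (C.freeVars ∪ (A.all x).freeVars)
  simp only [Finset.mem_union, not_or] at hyC
  obtain ⟨B, hB⟩ := exists_subst [(x, .var y)] A
  refine ⟨y, B, hB.cls_eq, fun h => hC ?_⟩
  refine Derivable.bot_of_neg_witness hB (fun G hG => ?_) hyC.2 (.intro h.insert_and)
  rcases hG with rfl | hG
  · exact hyC.1
  · exact hy G hG

/-- Suppose that `C` is consistent with the known formulae but that every instance `B` of `A` at a
variable makes `B → ∀ x. A` inconsistent with them and `C`. Then `K_a (C → ¬(B → ∀ x. A))` is in `w`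
for each of these. The witness property of `w` makes this a universal formula, `Derivable.barcan`
moves the quantifier inside `K_a`, and the resulting known formula refutes `C`. -/
theorem Saturated.exists_know [Countable Pred] {w : Set (Formula ar)} (hw : Saturated w) {a : ℕ}
    {A₀ : Formula ar} (hA₀ : A₀.know a ∉ w) :
    ∃ v, Saturated v ∧ (∀ A : Formula ar, A.know a ∈ w → A ∈ v) ∧ A₀ ∉ v := by
  have hnec {A : Formula ar} (h : Derivable {A | A.know a ∈ w} A) : A.know a ∈ w := by
    refine hw.mem_of_derivable (h.know_intro.mono ?_)
    rintro _ ⟨B, hB, rfl⟩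
    exact hB
  have hT (C : Formula ar) (x : ℕ) (A : Formula ar)
      (hC : ¬Derivable (insert C {A | A.know a ∈ w}) .bot) :
      ∃ (y : ℕ) (B : Formula ar), B.cls = A.instCls x (.var y) ∧
        ¬Derivable (insert (C.and (B.imp (A.all x))) {A | A.know a ∈ w}) .bot := by
    by_contra! hcon
    obtain ⟨z, hz⟩ := Infinite.exists_notMem_finset (C.freeVars ∪ A.freeVars)
    simp only [Finset.mem_union, not_or] at hz
    have hzA : z ∉ (A.all x).freeVars := fun h => hz.2 (Finset.mem_erase.1 h).2
    obtain ⟨B₀, hB₀⟩ := exists_subst [(x, .var z)] A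
    have hall : ((C.imp (B₀.imp (A.all x)).neg).know a).all z ∈ w := by
      by_contra hall
      obtain ⟨y, E, hE, hEw⟩ := hw.witness _ _ hall
      obtain ⟨B, hB⟩ := exists_subst [(x, .var y)] A
      have hmem := hnec (.intro (.intro (hcon y B hB.cls_eq).insert_and))
      refine hEw (hw.mem_of_cls_eq hmem (Eq.trans ?_ hE.symm))
      have hfresh {G : Formula ar} (hG : z ∉ G.freeVars) : G.cls = G.instCls z (.var y) := by
        have : ∀ n ∈ G.freeVars, LTerm.free (.var n) =
            Function.update (fun n => LTerm.free (.var n)) z (.free (.var y)) n := fun n hn => by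
          have : n ≠ z := fun e => hG (e ▸ hn)
          rw [Function.update_of_ne this]
        exact Formula.tr_congr this this
      -- As `z` is not free in `A`, going from `x` to `y` by way of `z` gives the same class as
      -- going directly.
      have hB₁ : B.cls = B₀.instCls z (.var y) := by
        rw [hB.cls_eq, Formula.instCls, Formula.instCls, hB₀.tr_eq, substEnv_singleton]
        have : ∀ n ∈ A.freeVars, Function.update (fun n => LTerm.free (.var n)) x
            (.free (.var y)) n = Function.update (Function.update (fun n => LTerm.free (.var n)) z
            (.free (.var y))) x ((Term.var z).eval (Function.update
            (fun n => LTerm.free (.var n)) z (.free (.var y)))) n := fun n hn => by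
          by_cases hnx : n = x
          · subst hnx; simp [Term.eval]
          · have : n ≠ z := fun e => hz.2 (e ▸ hn)
            simp [hnx, this]
        exact Formula.tr_congr this this
      exact congrArg (LFormula.know a) (congrArg₂ LFormula.imp (hfresh hz.1)
        (congrArg₂ LFormula.imp (congrArg₂ LFormula.imp hB₁ (hfresh hzA)) rfl))
    have hmem := hw.mem_of_derivable (Derivable.of_mem hall).barcan
    refine hC (Derivable.cut (T := {C, (C.imp (B₀.imp (A.all x)).neg).all z}) (fun G hG => ?_) ?_)
    · rcases hG with rfl | rfl
      · exact .of_mem (Set.mem_insert _ _)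
      · exact .of_mem (.inr hmem)
    · refine Derivable.bot_of_neg_witness hB₀ (fun G hG => ?_) hzA ?_
      · rcases hG with rfl | rfl
        · exact hz.1
        · simp [Formula.freeVars]
      · exact .mp (A := C) (.all_elim (.refl_var z _) (.of_mem (by simp))) (.of_mem (by simp))
  obtain ⟨v, hv, hTv, hA⟩ := exists_saturated hT A₀.neg fun h => hA₀ (hnec (.by_contra h))
  exact ⟨v, hv, fun A hA => hTv hA, hv.neg_mem_iff.1 hA⟩

/-! ### The canonical model -/

/-- The map of arguments that reads the free variables by `ρ`. -/
def LTerm.bind (ρ : ℕ → LTerm) : LTerm → LTerm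
  | free t => t.eval ρ
  | bound n => bound n

theorem LTerm.fixesCompound_bind (ρ : ℕ → LTerm) : FixesCompound (LTerm.bind ρ) := fun t ht => by
  cases t <;> simp_all [Term.asVar, LTerm.bind, Term.eval]

namespace Formula

/-- The nameless translation when the variables are read as terms. -/
def read (ρ : ℕ → Term) (A : Formula ar) : LFormula ar :=
  A.tr (fun n => .free (ρ n)) (fun n => .free (ρ n))

theorem map_cls (ρ₁ ρ₂ : ℕ → LTerm) (A : Formula ar) :
    A.cls.map (LTerm.bind ρ₁) (LTerm.bind ρ₂) = A.tr ρ₁ ρ₂ :=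
  map_tr (LTerm.fixesCompound_bind ρ₁) (LTerm.fixesCompound_bind ρ₂) A _ _

/-- A formula whose substitutions of identicals are those of `A` read by `ρ`. -/
theorem exists_read_idSubst (A : Formula ar) (x : ℕ) (ρ : ℕ → Term) :
    ∃ (C : Formula ar) (z : ℕ), ∀ (u : Term) (B : Formula ar), IdSubst u z C B →
      B.cls = A.tr (Function.update (fun n => .free (ρ n)) x (.free u)) (fun n => .free (ρ n)) := by
  obtain ⟨z, hz⟩ := Infinite.exists_notMem_finset
    (A.freeVars ∪ A.freeVars.biUnion fun n => (ρ n).asVar)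
  simp only [Finset.mem_union, not_or, Finset.mem_biUnion, not_exists, not_and] at hz
  -- `z` marks the places of `x` outside the modal operators. It is foreign to the free variables of
  -- `A` and their values under `ρ`, so the marks stay recognisable after the other variables are
  -- read.
  obtain ⟨A', hA'⟩ := exists_idSubst (.var z) x A
  obtain ⟨C, hC⟩ := exists_cls_eq (Function.update ρ z (.var z)) A'
  refine ⟨C, z, fun u B hB => ?_⟩
  have hC' := congrArg (LFormula.map
    (LTerm.bind (Function.update (fun n => .free (.var n)) z (.free u)))
    (LTerm.bind (fun n => .free (.var n)))) hC
  rw [map_cls, hA'.tr_eq, map_tr (LTerm.fixesCompound_bind _) (LTerm.fixesCompound_bind _)] at hC'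
  rw [cls, hB.tr_eq, Term.eval_free_var, hC']
  refine tr_congr (fun n hn => ?_) (fun n hn => ?_)
  · have hnz : n ≠ z := fun e => hz.1 (e ▸ hn)
    by_cases hnx : n = x
    · subst hnx; simp [LTerm.bind, Term.eval]
    · simp only [Function.comp, Function.update_of_ne hnx, Function.update_of_ne hnz, LTerm.bind]
      have := hz.2 n hn
      refine (Term.eval_congr (ρ' := fun n => .free (.var n)) fun m hm => ?_).trans
        (Term.eval_free_var _)
      rw [Function.update_of_ne]
      exact fun e => this (e ▸ hm)
  · have hnz : n ≠ z := fun e => hz.1 (e ▸ hn)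
    simp [Function.update_of_ne hnz, LTerm.bind, Term.eval_free_var]

end Formula

/-- `A` is read by every `ρ` that agrees with `δ` on `D` as (the class of) `B`. -/
def ReadsAs (D : Set ℕ) (δ : ℕ → ℕ) (A B : Formula ar) : Prop :=
  ∀ ρ : ℕ → Term, (∀ n ∈ D, ρ n = .var (δ n)) → A.read ρ = B.cls

/-- The evidence function of the canonical model at a saturated set. -/
def evidence (D : Set ℕ) (δ : ℕ → ℕ) (w : Set (Formula ar)) (j : Term) : Set (Formula ar) :=
  {A | ∃ B, ReadsAs D δ A B ∧ B.just j ∈ w}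

/-! ### Closure properties of the canonical evidence function -/

section evidence

variable {D : Set ℕ} {δ : ℕ → ℕ} {w : Set (Formula ar)}

theorem evidence_bang (hw : Saturated w) {j : Term} {A : Formula ar}
    (h : A ∈ evidence D δ w j) : A.just j ∈ evidence D δ w (.bang j) := by
  obtain ⟨B, hB, hBw⟩ := h
  exact ⟨B.just j, fun ρ hρ => congrArg (LFormula.just j) (hB ρ hρ),
    hw.mem_of_derivable (Derivable.of_mem hBw).just_bang⟩

theorem ReadsAs.cls_eq {A B : Formula ar} (h : ReadsAs D δ A B) :
    A.read (fun n => .var (δ n)) = B.cls := h _ fun _ _ => rfl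

theorem evidence_app (hw : Saturated w) {j k : Term} {A B : Formula ar}
    (h : A.imp B ∈ evidence D δ w j) (h' : A ∈ evidence D δ w k) :
    B ∈ evidence D δ w (.app j k) := by
  obtain ⟨C, hC, hCw⟩ := h
  obtain ⟨A', hA, hAw⟩ := h'
  -- Equality of classes forces `C` to be an implication; its antecedent and `A'` need only agree up
  -- to renaming.
  have hcls := hC.cls_eq
  cases C with
  | imp A'' B' =>
    simp only [Formula.read, Formula.cls, Formula.tr, LFormula.imp.injEq] at hcls
    have hA' : A'.cls = A''.cls := hA.cls_eq.symm.trans hcls.1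
    refine ⟨B', fun ρ hρ => ?_, hw.mem_of_derivable (.just_app (.of_mem hCw) (.of_mem
      (hw.mem_of_cls_eq hAw (congrArg (LFormula.just k) ?_))))⟩
    · have := hC ρ hρ
      simp only [Formula.read, Formula.cls, Formula.tr, LFormula.imp.injEq] at this
      exact this.2
    · exact hA'
  | _ => simp [Formula.read, Formula.cls, Formula.tr] at hcls

/-- The terms `t` and `s` have fixed readings `t'` and `s'`. Replacing `t` by `s` in evidence
becomes replacing `t'` by `s'` in a formula justified in `w`, where `hw` applies;
`Formula.exists_read_idSubst` supplies the common template. -/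
theorem evidence_subst_aux {j t s : Term} {x : ℕ} {A B C : Formula ar}
    (hB : IdSubst t x A B) (hC : IdSubst s x A C) {t' s' : Term}
    (ht : ∀ ρ : ℕ → Term, (∀ n ∈ D, ρ n = .var (δ n)) → t.eval (fun n => .free (ρ n)) = .free t')
    (hs : ∀ ρ : ℕ → Term, (∀ n ∈ D, ρ n = .var (δ n)) → s.eval (fun n => .free (ρ n)) = .free s')
    (hw : ∀ A B C x, IdSubst t' x A B → IdSubst s' x A C → B.just j ∈ w → C.just j ∈ w)
    (hsat : Saturated w) (h : B ∈ evidence D δ w j) : C ∈ evidence D δ w j := by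
  obtain ⟨B', hB', hBw⟩ := h
  obtain ⟨A', z, hA'⟩ := A.exists_read_idSubst x fun n => .var (δ n)
  obtain ⟨B₁, hB₁⟩ := exists_idSubst t' z A'
  obtain ⟨C₁, hC₁⟩ := exists_idSubst s' z A'
  have hBr (ρ : ℕ → Term) (hρ : ∀ n ∈ D, ρ n = .var (δ n)) : B.read ρ =
      A.tr (Function.update (fun n => .free (ρ n)) x (.free t')) (fun n => .free (ρ n)) := by
    rw [Formula.read, hB.tr_eq, ht ρ hρ]
  have hCr (ρ : ℕ → Term) (hρ : ∀ n ∈ D, ρ n = .var (δ n)) : C.read ρ =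
      A.tr (Function.update (fun n => .free (ρ n)) x (.free s')) (fun n => .free (ρ n)) := by
    rw [Formula.read, hC.tr_eq, hs ρ hρ]
  refine ⟨C₁, fun ρ hρ => ?_, hw _ _ _ _ hB₁ hC₁ (hsat.mem_of_cls_eq hBw ?_)⟩
  · rw [hCr ρ hρ, hA' _ _ hC₁]
    have := (hB' ρ hρ).trans hB'.cls_eq.symm
    rw [hBr ρ hρ, hBr _ fun _ _ => rfl] at this
    -- The reading of `B` does not depend on `ρ` outside `D`; overwriting `t'` by `s'` at `x`
    -- carries this over to `C`.
    have := Formula.tr_update_congr this x (.free s')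
    rwa [Function.update_idem, Function.update_idem] at this
  · refine congrArg (LFormula.just j) (hB'.cls_eq.symm.trans ?_)
    rw [hBr _ fun _ _ => rfl]
    exact (hA' _ _ hB₁).symm

theorem exists_of_eq_mem_evidence {k t s : Term}
    (h : Formula.eq t s ∈ evidence (ar := ar) D δ w k) : ∃ t' s',
      (∀ ρ : ℕ → Term, (∀ n ∈ D, ρ n = .var (δ n)) → t.eval (fun n => .free (ρ n)) = .free t') ∧
      (∀ ρ : ℕ → Term, (∀ n ∈ D, ρ n = .var (δ n)) → s.eval (fun n => .free (ρ n)) = .free s') ∧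
      Formula.just k (.eq t' s') ∈ w := by
  obtain ⟨E, hE, hw⟩ := h
  have hcls := hE.cls_eq
  cases E with
  | eq t' s' =>
    have key (ρ : ℕ → Term) (hρ : ∀ n ∈ D, ρ n = .var (δ n)) := hE ρ hρ
    simp only [Formula.read, Formula.cls, Formula.tr, LFormula.eq.injEq,
      Term.eval_free_var] at key
    exact ⟨t', s', fun ρ hρ => (key ρ hρ).1, fun ρ hρ => (key ρ hρ).2, hw⟩
  | _ => simp [Formula.read, Formula.cls, Formula.tr] at hcls

theorem evidence_subst (hw : Saturated w) {j t s : Term} {x : ℕ} {A B C : Formula ar}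
    (hB : IdSubst t x A B) (hC : IdSubst s x A C) (h : B ∈ evidence D δ w j)
    (hk : ∃ k, Formula.eq t s ∈ evidence D δ w k ∨ Formula.eq s t ∈ evidence D δ w k) :
    C ∈ evidence D δ w j := by
  obtain ⟨k, hk | hk⟩ := hk
  · obtain ⟨t', s', ht, hs, hmem⟩ := exists_of_eq_mem_evidence hk
    exact evidence_subst_aux hB hC ht hs (fun _ _ _ _ hB hC h => hw.mem_of_derivable
      (.just_subst hB hC (.of_mem hmem) (.of_mem h))) hw h
  · obtain ⟨s', t', hs, ht, hmem⟩ := exists_of_eq_mem_evidence hk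
    exact evidence_subst_aux hB hC ht hs (fun _ _ _ _ hB hC h => hw.mem_of_derivable
      (.just_subst_symm hB hC (.of_mem hmem) (.of_mem h))) hw h

end evidence

/-- Uniform replacement is one substitution of identicals: a fresh variable `x` marks exactly the
arguments equal to `e i`. -/
theorem Saturated.pred_congr {w : Set (Formula ar)} (hw : Saturated w) {P : Pred}
    {e e' : Fin (ar P) → Term} {i : Fin (ar P)} {d : Term} (he : Formula.pred P e ∈ w)
    (hd : Formula.eq (e i) d ∈ w)
    (h : ∀ k, (e k ≠ e i → e' k = e k) ∧ (e k = e i → e' k = d)) : Formula.pred P e' ∈ w := by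
  classical
  obtain ⟨x, hx⟩ := Infinite.exists_notMem_finset (Finset.univ.biUnion fun k => (e k).asVar)
  simp only [Finset.mem_biUnion, Finset.mem_univ, true_and, not_exists] at hx
  set a : Fin (ar P) → Term := fun k => if e k = e i then .var x else e k with ha
  have hsub (u : Term) (k : Fin (ar P)) :
      (a k).replace [(x, u)] = if e k = e i then u else e k := by
    rw [Term.replace_singleton]
    by_cases hk : e k = e i
    · simp [ha, hk, Term.subst]
    · simp only [ha, hk, if_false]
      refine (Term.subst_congr fun n hn => ?_).trans (Term.subst_var _)
      rw [Function.update_of_ne]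
      exact fun h => hx k (h ▸ hn)
  have h₁ := IdSubst.pred (u := e i) (v := x) P a
  have h₂ := IdSubst.pred (u := d) (v := x) P a
  simp only [hsub] at h₁ h₂
  have e₁ : (fun k => if e k = e i then e i else e k) = e := by
    funext k; split_ifs with hk <;> simp [hk]
  have e₂ : (fun k => if e k = e i then d else e k) = e' := by
    funext k; split_ifs with hk
    · exact ((h k).2 hk).symm
    · exact ((h k).1 hk).symm
  rw [e₁] at h₁
  rw [e₂] at h₂
  exact hw.mem_of_derivable (.eq_subst h₁ h₂ (.of_mem hd) (.of_mem he))

/-- The canonical model: its states are the saturated sets, the variable `n` denotes `δ n`, and all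
other terms denote themselves. -/
def canonicalModel (D : Set ℕ) (δ : ℕ → ℕ) (hδ : Function.Surjective δ)
    (w₀ : {w : Set (Formula ar) // Saturated w}) : Model ar where
  W := {w : Set (Formula ar) // Saturated w}
  nonempty_W := ⟨w₀⟩
  R a w v := ∀ A : Formula ar, A.know a ∈ w.1 ↔ A.know a ∈ v.1
  R_refl _ _ _ := Iff.rfl
  R_eucl _ _ _ _ h h' A := (h A).symm.trans (h' A)
  Rγ w v := ∀ (j : Term) (A : Formula ar), A.just j ∈ w.1 → A.just j ∈ v.1
  Rγ_refl _ _ _ := id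
  Rγ_trans _ _ _ h h' j A hA := h' j A (h j A hA)
  U := ULift.{u} Term
  nonempty_U := ⟨⟨.var 0⟩⟩
  I w :=
    { term := fun t => ⟨t.subst fun n => .var (δ n)⟩
      eq := fun t s => Formula.eq t.down s.down ∈ w.1
      pred := fun P e => Formula.pred P (fun i => (e i).down) ∈ w.1 }
  I_rigid _ _ _ := rfl
  I_surj _ e := by
    obtain ⟨t⟩ := e
    cases t with
    | var n =>
      obtain ⟨m, rfl⟩ := hδ n
      exact ⟨.var m, rfl⟩
    | app t s => exact ⟨.app t s, rfl⟩
    | lam n t => exact ⟨.lam n t, rfl⟩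
    | bang t => exact ⟨.bang t, rfl⟩
  eq_refl w e := w.2.mem_of_derivable (.of_deriv (.eq_refl _))
  eq_symm w _ _ h := w.2.mem_of_derivable (Derivable.of_mem h).eq_symm
  eq_trans w _ _ _ h h' := w.2.mem_of_derivable (Derivable.of_mem h |>.eq_trans (.of_mem h'))
  pred_congr w P e e' i d he hd h := w.2.pred_congr he hd fun k =>
    ⟨fun hk => congrArg _ ((h k).1 fun hk' => hk (congrArg _ hk')),
      fun hk => congrArg _ ((h k).2 (ULift.down_injective hk))⟩
  E w j := evidence D δ w.1 j
  E_mono _ _ t h _ := fun ⟨B, hB, hBw⟩ => ⟨B, hB, h t B hBw⟩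
  E_bang w _ _ h := evidence_bang w.2 h
  E_app w _ _ _ _ h h' := evidence_app w.2 h h'
  E_subst w _ _ _ _ _ _ _ hB hC h hk := evidence_subst w.2 hB hC h hk

/-! ### The truth lemma -/

section truth

variable {D : Set ℕ} {δ : ℕ → ℕ} {hδ : Function.Surjective δ}
  {w₀ : {w : Set (Formula ar) // Saturated w}}

/-- If `f(tᵢ) = f(xᵢ)`, then `A[t₁/x₁ …]` and `A` are read alike by `f`; as `f` follows `δ` on `D`,
the evidence is a formula of the class of `B`. Conversely, naming the values of the free variables
by means of `D` turns `A` into evidence. -/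
theorem Saturated.forces_just_iff {d : ℕ → ℕ} (hd : ∀ n, d n ∈ D ∧ δ (d n) = n)
    {A : Formula ar} {j : Term} {w : Set (Formula ar)} (hw : Saturated w)
    {f : Term → Term}
    (hf : ∀ t : Term, (∀ n ∈ t.asVar, n ∈ D) → f t = t.subst fun n => .var (δ n))
    {B : Formula ar} (hB : B.cls = A.read fun n => f (.var n)) :
    (∃ l : List (ℕ × Term), (l.map Prod.fst).Nodup ∧
      (∀ x, x ∈ l.map Prod.fst ↔ x ∈ A.freeVars) ∧ (∀ p ∈ l, f p.2 = f (.var p.1)) ∧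
      ∃ C, Subst l A C ∧ C ∈ evidence D δ w j) ↔ B.just j ∈ w := by
  have heval (t : Term) : t.eval (fun n => .free (f (.var n))) = .free (f t) := by
    cases t with
    | var n => rfl
    | _ => rw [hf _ (by simp [Term.asVar])]; rfl
  constructor
  · rintro ⟨l, -, hl, hlf, C, hAC, B', hB', hw'⟩
    refine hw.mem_of_cls_eq hw' (congrArg (LFormula.just j) (Eq.trans ?_ hB.symm))
    change B'.cls = _
    rw [← hB' (fun n => f (.var n)) fun n hn => hf _ (by simpa [Term.asVar] using hn),
      Formula.read, hAC.tr_eq]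
    have : ∀ x ∈ A.freeVars, substEnv l (fun n => .free (f (.var n))) x = .free (f (.var x)) := by
      intro x hx
      obtain ⟨p, hp, rfl⟩ := List.mem_map.1 ((hl x).2 hx)
      cases h : l.lookup p.1 with
      | none => simp [substEnv, Term.replace, h, Term.eval]
      | some t =>
        simp only [substEnv, Term.replace, h, Option.getD_some, heval]
        rw [hlf _ (mem_of_lookup h)]
    exact Formula.tr_congr this this
  · intro hmem
    -- `σ x` is the name of `f(x)`: a variable `n` is named by `d n` in `D`, and a compound term by
    -- itself.
    set σ : ℕ → Term := fun x => (f (.var x)).subst fun n => .var (d n) with hσ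
    have hread (ρ : ℕ → Term) (hρ : ∀ n ∈ D, ρ n = .var (δ n)) (t : Term) :
        (t.subst fun n => .var (d n)).eval (fun n => .free (ρ n)) = .free t := by
      cases t with
      | var n => simp [Term.subst, Term.eval, hρ _ (hd n).1, (hd n).2]
      | _ => rfl
    obtain ⟨C, hC⟩ := exists_subst (A.freeVars.toList.map fun x => (x, σ x)) A
    refine ⟨_, ?_, fun x => ?_, ?_, C, hC, B, fun ρ hρ => ?_, hmem⟩
    · simpa [Function.comp_def] using A.freeVars.nodup_toList
    · simp
    · intro p hp
      obtain ⟨x, -, rfl⟩ := List.mem_map.1 hp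
      have hD : ∀ n ∈ (σ x).asVar, n ∈ D := fun n hn => by
        obtain ⟨m, -, hm⟩ := Term.mem_asVar_subst hn
        rw [Term.asVar, Finset.mem_singleton] at hm
        exact hm ▸ (hd m).1
      refine (hf _ hD).trans ((Term.subst_subst _ _ _).trans ?_)
      exact (Term.subst_congr fun n _ => by simp only [Term.subst, hd]).trans (Term.subst_var _)
    · rw [hB, Formula.read, hC.tr_eq]
      have : ∀ x ∈ A.freeVars, substEnv (A.freeVars.toList.map fun x => (x, σ x))
          (fun n => .free (ρ n)) x = .free (f (.var x)) := fun x hx => by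
        simp only [substEnv, Term.replace, lookup_map_mk σ (Finset.mem_toList.2 hx),
          Option.getD_some]
        exact hread ρ hρ _
      exact Formula.tr_congr this this

/-- Assignments may send variables to arbitrary terms, so membership is asserted of any `B` of the
class of `A` read by `f`. Only the values of compound terms and of variables in `D` are prescribed,
a condition that variants at the bound variables of `A` respect. -/
theorem canonicalModel_forces_iff [Countable Pred] {d : ℕ → ℕ}
    (hd : ∀ n, d n ∈ D ∧ δ (d n) = n) {A : Formula ar} (hA : ∀ x ∈ A.quantified, x ∉ D)
    (w : {w : Set (Formula ar) // Saturated w}) (f : Assignment ar (ULift.{u} Term))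
    (hf : ∀ t : Term, (∀ n ∈ t.asVar, n ∈ D) → f.term t = ⟨t.subst fun n => .var (δ n)⟩)
    (heq : f.eq = ((canonicalModel D δ hδ w₀).I w).eq)
    (hpred : f.pred = ((canonicalModel D δ hδ w₀).I w).pred)
    {B : Formula ar} (hB : B.cls = A.read fun n => (f.term (.var n)).down) :
    (canonicalModel D δ hδ w₀).Forces w f A ↔ B ∈ w.1 := by
  have heval (t : Term) {f : Assignment ar (ULift.{u} Term)}
      (hf : ∀ t : Term, (∀ n ∈ t.asVar, n ∈ D) → f.term t = ⟨t.subst fun n => .var (δ n)⟩) :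
      t.eval (fun n => .free (f.term (.var n)).down) = .free (f.term t).down := by
    cases t with
    | var n => rfl
    | _ => rw [hf _ (by simp [Term.asVar])]; rfl
  induction A generalizing w f B with
  | bot =>
    cases B with
    | bot => exact iff_of_false id w.2.bot_notMem
    | _ => simp [Formula.read, Formula.cls, Formula.tr] at hB
  | eq t s =>
    cases B with
    | eq t' s' =>
      simp only [Formula.read, Formula.cls, Formula.tr, LFormula.eq.injEq, Term.eval_free_var,
        heval _ hf, LTerm.free.injEq] at hB
      change f.eq (f.term t) (f.term s) ↔ _
      rw [hB.1, hB.2, heq]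
      exact Iff.rfl
    | _ => simp [Formula.read, Formula.cls, Formula.tr] at hB
  | pred P ts =>
    cases B with
    | pred Q us =>
      simp only [Formula.read, Formula.cls, Formula.tr, LFormula.pred.injEq] at hB
      obtain ⟨rfl, hB⟩ := hB
      have : us = fun i => (f.term (ts i)).down := funext fun i => by
        have := congrFun (eq_of_heq hB) i
        simpa only [Term.eval_free_var, heval _ hf, LTerm.free.injEq] using this
      change f.pred _ (fun i => f.term (ts i)) ↔ _
      rw [this, hpred]
      exact Iff.rfl
    | _ => simp [Formula.read, Formula.cls, Formula.tr] at hB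
  | imp A₁ A₂ ih₁ ih₂ =>
    simp only [Formula.quantified, Finset.mem_union] at hA
    cases B with
    | imp B₁ B₂ =>
      simp only [Formula.read, Formula.cls, Formula.tr, LFormula.imp.injEq] at hB
      exact (imp_congr (ih₁ (fun x hx => hA x (.inl hx)) w f hf heq hpred hB.1)
        (ih₂ (fun x hx => hA x (.inr hx)) w f hf heq hpred hB.2)).trans w.2.imp_mem_iff.symm
    | _ => simp [Formula.read, Formula.cls, Formula.tr] at hB
  | and A₁ A₂ ih₁ ih₂ =>
    simp only [Formula.quantified, Finset.mem_union] at hA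
    cases B with
    | and B₁ B₂ =>
      simp only [Formula.read, Formula.cls, Formula.tr, LFormula.and.injEq] at hB
      exact (and_congr (ih₁ (fun x hx => hA x (.inl hx)) w f hf heq hpred hB.1)
        (ih₂ (fun x hx => hA x (.inr hx)) w f hf heq hpred hB.2)).trans w.2.and_mem_iff.symm
    | _ => simp [Formula.read, Formula.cls, Formula.tr] at hB
  | know a A ih =>
    cases B with
    | know b B =>
      simp only [Formula.read, Formula.cls, Formula.tr, LFormula.know.injEq] at hB
      obtain ⟨rfl, hB⟩ := hB
      have ih' (v : {w : Set (Formula ar) // Saturated w}) :=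
        ih hA v ((canonicalModel D δ hδ w₀).shift f v) hf rfl rfl hB
      constructor
      · intro h
        by_contra hBw
        obtain ⟨v, hv, hwv, hBv⟩ := w.2.exists_know hBw
        -- Positive introspection makes every `K_a C` of `w` hold at `v`, and negative introspection
        -- excludes any further ones.
        refine hBv ((ih' ⟨v, hv⟩).1 (h ⟨v, hv⟩ fun C => ⟨fun hC => ?_, fun hC => ?_⟩))
        · exact hwv _ (w.2.mem_of_derivable (Derivable.of_mem hC).know_know)
        · by_contra hCw
          refine hv.neg_mem_iff.1 (hwv _ (w.2.mem_of_derivable ?_)) hC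
          exact (Derivable.of_mem (w.2.neg_mem_iff.2 hCw)).know_neg
      · intro h v hwv
        exact (ih' v).2 (v.2.mem_of_derivable (Derivable.of_mem ((hwv B).1 h)).know_elim)
    | _ => simp [Formula.read, Formula.cls, Formula.tr] at hB
  | just j A ih =>
    cases B with
    | just k B =>
      simp only [Formula.read, Formula.cls, Formula.tr, LFormula.just.injEq] at hB
      obtain ⟨rfl, hB⟩ := hB
      have ih' (v : {w : Set (Formula ar) // Saturated w}) :=
        ih hA v ((canonicalModel D δ hδ w₀).shift f v) hf rfl rfl hB
      have hj := w.2.forces_just_iff hd (A := A) (j := k) (B := B)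
        (f := fun t => (f.term t).down) (fun t ht => congrArg ULift.down (hf t ht)) hB
      have hdown : ∀ t s : Term, f.term t = f.term s ↔ (f.term t).down = (f.term s).down :=
        fun t s => ULift.down_injective.eq_iff.symm
      simp only [← hdown] at hj
      rw [← hj]
      -- Evidence alone suffices: `k : B` persists along `Rγ` and is factive, so the truth of `A` at
      -- accessible states is automatic.
      refine and_iff_right_of_imp fun h v hwv => (ih' v).2 ?_
      exact v.2.mem_of_derivable (Derivable.of_mem (hwv k B (hj.1 h))).just_elim
    | _ => simp [Formula.read, Formula.cls, Formula.tr] at hB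
  | all x A ih =>
    simp only [Formula.quantified, Finset.mem_insert, forall_eq_or_imp] at hA
    cases B with
    | all z B =>
      simp only [Formula.read, Formula.cls, Formula.tr, LFormula.all.injEq] at hB
      have hinst (t : Term) (g : Assignment ar (ULift.{u} Term)) (hg : f.IsVariant x g)
          (hgx : (g.term (.var x)).down = t) (C : Formula ar) (hC : C.cls = B.instCls z t) :
          (canonicalModel D δ hδ w₀).Forces w g A ↔ C ∈ w.1 := by
        refine ih hA.2 w g (fun s hs => ?_) (hg.2.1.trans heq) (hg.2.2.trans hpred) ?_
        · rw [hg.1 s, hf s hs]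
          rintro rfl
          exact hA.1 (hs x (by simp [Term.asVar]))
        · rw [hC, Formula.instCls, Formula.tr_update_of_bindEnv hB]
          have : Function.update (fun n => LTerm.free (f.term (.var n)).down) x (.free t) =
              fun n => .free (g.term (.var n)).down := by
            funext n
            by_cases hn : n = x
            · subst hn; simp [hgx]
            · rw [Function.update_of_ne hn, hg.1 _ fun e => hn (Term.var.inj e)]
          rw [this, Formula.read]
      constructor
      · intro h
        by_contra hBw
        -- A failing instance at a variable gives a falsifying variant of `f`, since the variable is
        -- itself an element of the domain.
        obtain ⟨y, C, hC, hCw⟩ := w.2.witness z B hBw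
        classical
        let g : Assignment ar (ULift.{u} Term) :=
          ⟨fun t => if t = .var x then ⟨.var y⟩ else f.term t, f.eq, f.pred⟩
        have hg : f.IsVariant x g := ⟨fun t ht => if_neg ht, rfl, rfl⟩
        exact hCw ((hinst (.var y) g hg (by simp [g]) C hC).1 (h g hg))
      · intro h g hg
        obtain ⟨C, hC⟩ := exists_subst [(z, (g.term (.var x)).down)] B
        exact (hinst _ g hg rfl C hC.cls_eq).2
          (w.2.mem_of_derivable ((Derivable.of_mem h).all_elim hC))
    | _ => simp [Formula.read, Formula.cls, Formula.tr] at hB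

end truth

end EJL

/-- Completeness. The hypothesis `hΓ` (infinitely many variables neither occur nor are quantified in
`Γ`) holds automatically when `Γ` is finite, that is, the underlying set of a finite multiset. -/
theorem mainTheorem2 {Pred : Type u} [Countable Pred] (ar : Pred → ℕ)
    (Γ : Set (EJL.Formula ar)) (A : EJL.Formula ar)
    (hΓ : {x : ℕ | ∀ G ∈ Γ, x ∉ G.occurring ∧ x ∉ G.quantified}.Infinite)
    (h : EJL.Entails Γ A) : EJL.Derivable Γ A := by
  open EJL in
  by_contra hcon
  have hD := hΓ.sdiff (A.occurring ∪ A.quantified).finite_toSet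
  set D := {x : ℕ | ∀ G ∈ Γ, x ∉ G.occurring ∧ x ∉ G.quantified} \
    ((A.occurring ∪ A.quantified : Finset ℕ) : Set ℕ) with hDdef
  obtain ⟨w, hw, hΓw, hAw⟩ := exists_saturated_of_infinite
    (hΓ.mono fun x hx G hG hxG => (hx G hG).1 (G.freeVars_subset_occurring hxG))
    A.neg fun h => hcon (.by_contra h)
  classical
  let d := hD.natEmbedding
  -- On the range of `d` this inverts `d`; at any remaining points of `D` the default value of
  -- `Function.invFun` is harmless.
  let δ : ℕ → ℕ := fun n => if n ∈ D then Function.invFun (fun m => (d m : ℕ)) n else n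
  have hd (n : ℕ) : (d n : ℕ) ∈ D ∧ δ (d n) = n := by
    have hinj : Function.Injective fun m => (d m : ℕ) :=
      Subtype.val_injective.comp d.injective
    refine ⟨(d n).2, ?_⟩
    simp only [δ, if_pos (d n).2]
    exact Function.leftInverse_invFun hinj n
  have key (G : Formula ar) (ho : ∀ x ∈ G.occurring, x ∉ D) (hq : ∀ x ∈ G.quantified, x ∉ D) :
      (canonicalModel D δ (fun n => ⟨d n, (hd n).2⟩) ⟨w, hw⟩).Forces ⟨w, hw⟩
        ((canonicalModel D δ (fun n => ⟨d n, (hd n).2⟩) ⟨w, hw⟩).I ⟨w, hw⟩) G ↔ G ∈ w := by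
    refine canonicalModel_forces_iff (d := fun n => d n) hd hq ⟨w, hw⟩ _ (fun _ _ => rfl) rfl rfl ?_
    -- Outside `D` the map `δ` is the identity, so the canonical interpretation reads `G` as `G`
    -- itself.
    have : ∀ n ∈ G.freeVars, LTerm.free (.var n) = LTerm.free (.var (δ n)) := fun n hn => by
      simp only [δ, if_neg (ho n (G.freeVars_subset_occurring hn))]
    exact Formula.tr_congr this this
  refine hw.neg_mem_iff.1 hAw ((key A (fun x hx hxD => hxD.2 ?_) fun x hx hxD => hxD.2 ?_).1
    (h _ _ fun G hG => (key G (fun x hx hxD => (hxD.1 G hG).1 hx)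
      fun x hx hxD => (hxD.1 G hG).2 hx).2 (hΓw hG)))
  · simp [hx]
  · simp [hx]
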